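/- For positive integers $k_1,\dots,k_d$ let $\zeta^*(k_1,\dots,k_d)\in\mathbb R$ be the stuffle regularized multiple zeta value, normalized by $\zeta^*(1)=0$: it is the value at $T=0$ of the unique polynomial $Z(T)\in\mathbb R[T]$ with $$\sum_{0<m_1<\cdots<m_d\le N}\frac1{m_1^{k_1}\cdots m_d^{k_d}}-Z(\log N+\gamma)\longrightarrow 0\qquad(N\to\infty),$$ where $\gamma$ is Euler's constant; if $k_d\ge 2$ it is the usual multiple zeta value. Its value at the empty index is $1$. Let $$\zeta^{\star,*}(k_1,\dots,k_d)=\sum_{\square_1,\dots,\square_{d-1}\in\{\text{comma},\,+\}}\zeta^*(k_1\,\square_1\cdots\square_{d-1}\,k_d)$$ (equal to $1$ at the empty index), and for $a\ge 0$ let $$\zeta^*_a(k_1,\dots,k_d)=(-1)^a\sum_{\substack{a_1+\cdots+a_d=a\\ a_1,\dots,a_d\ge 0}}\zeta^*(k_1+a_1,\dots,k_d+a_d)\prod_{j=1}^d\binom{k_j-1+a_j}{a_j},$$ so that for the empty index it is $1$ if $a=0$ and $0$ if $a>0$. Let $\delta^{k_1,\dots,k_d}=\frac{(-1)^n\pi^{2n}}{(2n)!}$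 if $d=2n$ is even and $k_1=\cdots=k_d=1$, and $\delta^{k_1,\dots,k_d}=0$ otherwise. Let $B_n$ denote the Bernoulli numbers. **Theorem.** For all positive integers $k_1,\dots,k_d$ with $\sum_{j=1}^d k_j\not\equiv d\pmod 2$, $$\begin{aligned}\zeta^*(k_1,\dots,k_d)={}&\frac{\zeta^*(k_1,\dots,k_d)-\zeta^{\star,*}(k_1,\dots,k_d)}2-\frac12\sum_{i=0}^{d-1}(-1)^{d-i}\,\zeta^{\star,*}(k_1,\dots,k_i)\,\delta^{k_{i+1},\dots,k_d}\\&-\sum_{0\le i<j\le d}\ \sum_{\substack{a+2m+b=k_j\\ a,b,m\ge0}}(-1)^{m+i+b+k_1+\cdots+k_j}\frac{(2\pi)^{2m}}{2\,(2m)!}B_{2m}\,\zeta^{\star,*}(k_1,\dots,k_i)\,\zeta^*_a(k_{j-1},\dots,k_{i+1})\,\zeta^*_b(k_{j+1},\dots,k_d).\end{aligned}$$ -/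

import Mathlib

open Filter Topology

namespace MZV

/-- The truncated sum `∑ 1 / (m₁ ^ k₁ ⋯ m_d ^ k_d)` over all integers `a < m₁ < ⋯ < m_d ≤ N`. -/
noncomputable def truncSum (N : ℕ) : ℕ → List ℕ+ → ℝ
  | _, [] => 1
  | a, k :: ks => ∑ m ∈ Finset.Ioc a N, 1 / (m : ℝ) ^ (k : ℕ) * truncSum N m ks

/-- `P` is the polynomial (in the variable `T = log N + γ`) that describes the growth of the
truncated multiple harmonic sums `∑_{0 < m₁ < ⋯ < m_d ≤ N} 1 / (m₁ ^ k₁ ⋯ m_d ^ k_d)`,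
up to an error that tends to zero. -/
def IsRegPoly (k : List ℕ+) (P : Polynomial ℝ) : Prop :=
  Tendsto (fun N : ℕ =>
    truncSum N 0 k - P.eval (Real.log N + Real.eulerMascheroniConstant)) atTop (𝓝 0)

/-! ### Existence and uniqueness of the regularization polynomial -/

/-- `log N + γ` -/
noncomputable def logGamma (N : ℕ) : ℝ := Real.log N + Real.eulerMascheroniConstant

/-- Sequences that tend to zero faster than every power of `log N + γ`. -/
def Negligible (f : ℕ → ℝ) : Prop :=
  ∀ j : ℕ, Tendsto (fun N => f N * logGamma N ^ j) atTop (𝓝 0)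

/-- Polynomial growth in `log N + γ`, up to a negligible error. -/
def HasExpansion (f : ℕ → ℝ) : Prop :=
  ∃ P : Polynomial ℝ, Negligible (fun N => f N - P.eval (logGamma N))

theorem tendsto_logGamma : Tendsto logGamma atTop atTop :=
  tendsto_atTop_add_const_right _ _ (Real.tendsto_log_atTop.comp tendsto_natCast_atTop_atTop)

theorem Negligible.add {f g : ℕ → ℝ} (hf : Negligible f) (hg : Negligible g) :
    Negligible (fun N => f N + g N) := fun j => by
  simpa [add_mul] using (hf j).add (hg j)

theorem Negligible.const_mul {f : ℕ → ℝ} (c : ℝ) (hf : Negligible f) :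
    Negligible (fun N => c * f N) := fun j => by
  simpa [mul_assoc] using (hf j).const_mul c

theorem Negligible.mul {f g : ℕ → ℝ} (hf : Negligible f) (hg : Negligible g) :
    Negligible (fun N => f N * g N) := fun j => by
  have h := (hf j).mul (hg 0)
  simp only [mul_zero, pow_zero, mul_one] at h
  refine h.congr fun N => ?_
  ring

theorem Negligible.mul_eval {f : ℕ → ℝ} (hf : Negligible f) (P : Polynomial ℝ) :
    Negligible (fun N => f N * P.eval (logGamma N)) := by
  induction P using Polynomial.induction_on' with
  | add p q hp hq =>
    have h := hp.add hq
    simpa only [Polynomial.eval_add, mul_add] using h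
  | monomial n c =>
    intro j
    have h := (hf (n + j)).const_mul c
    rw [mul_zero] at h
    refine h.congr fun N => ?_
    simp only [Polynomial.eval_monomial]
    ring

theorem HasExpansion.add {f g : ℕ → ℝ} (hf : HasExpansion f) (hg : HasExpansion g) :
    HasExpansion (fun N => f N + g N) := by
  obtain ⟨P, hP⟩ := hf
  obtain ⟨Q, hQ⟩ := hg
  refine ⟨P + Q, ?_⟩
  have h := hP.add hQ
  convert h using 2 with N
  rw [Polynomial.eval_add]
  ring

theorem HasExpansion.const_mul {f : ℕ → ℝ} (c : ℝ) (hf : HasExpansion f) :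
    HasExpansion (fun N => c * f N) := by
  obtain ⟨P, hP⟩ := hf
  refine ⟨Polynomial.C c * P, ?_⟩
  have h := hP.const_mul c
  convert h using 2 with N
  rw [Polynomial.eval_mul, Polynomial.eval_C]
  ring

theorem HasExpansion.mul {f g : ℕ → ℝ} (hf : HasExpansion f) (hg : HasExpansion g) :
    HasExpansion (fun N => f N * g N) := by
  obtain ⟨P, hP⟩ := hf
  obtain ⟨Q, hQ⟩ := hg
  refine ⟨P * Q, ?_⟩
  have h := ((hP.mul_eval Q).add (hQ.mul_eval P)).add (hP.mul hQ)
  convert h using 2 with N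
  rw [Polynomial.eval_mul]
  ring

theorem hasExpansion_const (c : ℝ) : HasExpansion (fun _ => c) :=
  ⟨Polynomial.C c, fun j => by simp⟩

theorem HasExpansion.list_sum {F : List ℕ+ → ℕ → ℝ} (l : List (List ℕ+))
    (h : ∀ v ∈ l, HasExpansion (F v)) : HasExpansion (fun N => (l.map fun v => F v N).sum) := by
  induction l with
  | nil => simpa using hasExpansion_const 0
  | cons v l ih =>
    simp only [List.map_cons, List.sum_cons]
    exact (h v (by simp)).add (ih fun w hw => h w (by simp [hw]))

theorem negligible_of_le {f : ℕ → ℝ} (C : ℝ)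
    (h : ∀ᶠ N : ℕ in atTop, |f N| ≤ C * (N : ℝ) ^ (-(1 / 2) : ℝ)) : Negligible f := by
  intro j
  have h1 : Tendsto (fun N : ℕ => C * (N : ℝ) ^ (-(1 / 2) : ℝ) * logGamma N ^ j) atTop (𝓝 0) := by
    have h2 : Tendsto (fun x : ℝ => x ^ j * Real.exp (-(1 / 2) * x)) atTop (𝓝 0) := by
      have := tendsto_rpow_mul_exp_neg_mul_atTop_nhds_zero (j : ℝ) (1 / 2) (by norm_num)
      simpa using this
    have h3 := (h2.comp tendsto_logGamma).const_mul
      (C * Real.exp (1 / 2 * Real.eulerMascheroniConstant))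
    rw [mul_zero] at h3
    refine h3.congr' ?_
    filter_upwards [eventually_ge_atTop 1] with N hN
    have hN' : (0 : ℝ) < N := by exact_mod_cast hN
    simp only [Function.comp]
    rw [Real.rpow_def_of_pos hN']
    have : Real.exp (1 / 2 * Real.eulerMascheroniConstant) * Real.exp (-(1 / 2) * logGamma N)
        = Real.exp (Real.log N * (-(1 / 2))) := by
      rw [← Real.exp_add]
      congr 1
      unfold logGamma
      ring
    rw [← this]
    ring
  refine squeeze_zero_norm' ?_ h1
  filter_upwards [h, tendsto_logGamma.eventually_ge_atTop 0] with N hN h0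
  rw [norm_mul, norm_pow, Real.norm_eq_abs, Real.norm_eq_abs, abs_of_nonneg h0]
  exact mul_le_mul_of_nonneg_right hN (pow_nonneg h0 j)

theorem truncSum_one (N : ℕ) : truncSum N 0 [1] = (harmonic N : ℝ) := by
  rw [harmonic_eq_sum_Icc]
  simp only [truncSum, PNat.one_coe, pow_one, mul_one, one_div]
  push_cast
  rfl

theorem hasExpansion_one : HasExpansion (fun N => truncSum N 0 [1]) := by
  refine ⟨Polynomial.X, negligible_of_le 1 ?_⟩
  filter_upwards [eventually_ge_atTop 1] with N hN
  have hN' : (1 : ℝ) ≤ N := by exact_mod_cast hN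
  have h1 := Real.eulerMascheroniSeq_lt_eulerMascheroniConstant N
  have h2 := Real.eulerMascheroniConstant_lt_eulerMascheroniSeq' N
  rw [Real.eulerMascheroniSeq] at h1
  rw [Real.eulerMascheroniSeq', if_neg (by omega)] at h2
  rw [truncSum_one, Polynomial.eval_X, logGamma, one_mul]
  have h3 : Real.log ((N : ℝ) + 1) - Real.log N ≤ 1 / N := by
    rw [← Real.log_div (by positivity) (by positivity)]
    have := Real.log_le_sub_one_of_pos (x := ((N : ℝ) + 1) / N) (by positivity)
    have h4 : ((N : ℝ) + 1) / N - 1 = 1 / N := by field_simp; ring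
    linarith
  have h5 : 1 / (N : ℝ) ≤ (N : ℝ) ^ (-(1 / 2) : ℝ) := by
    rw [one_div, ← Real.rpow_neg_one]
    exact Real.rpow_le_rpow_of_exponent_le hN' (by norm_num)
  rw [abs_le]
  constructor <;> linarith

theorem truncSum_nonneg (N : ℕ) (k : List ℕ+) : ∀ a, 0 ≤ truncSum N a k := by
  induction k with
  | nil => intro a; simp [truncSum]
  | cons x k ih =>
    intro a
    exact Finset.sum_nonneg fun m _ => mul_nonneg (by positivity) (ih m)

theorem truncSum_le (N : ℕ) (k : List ℕ+) : ∀ a, truncSum N a k ≤ (harmonic N : ℝ) ^ k.length := by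
  induction k with
  | nil => intro a; simp [truncSum]
  | cons x k ih =>
    intro a
    rw [List.length_cons, pow_succ', ← truncSum_one]
    simp only [truncSum, PNat.one_coe, pow_one, mul_one]
    rw [Finset.sum_mul]
    calc ∑ m ∈ Finset.Ioc a N, 1 / (m : ℝ) ^ (x : ℕ) * truncSum N m k
        ≤ ∑ m ∈ Finset.Ioc a N, 1 / (m : ℝ) * (truncSum N 0 [1]) ^ k.length := by
          refine Finset.sum_le_sum fun m hm => ?_
          have hm1 : (1 : ℝ) ≤ m := by
            have := (Finset.mem_Ioc.1 hm).1
            exact_mod_cast (by omega : 1 ≤ m)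
          refine mul_le_mul ?_ ?_ (truncSum_nonneg N k m) (by positivity)
          · exact one_div_le_one_div_of_le (by positivity) (le_self_pow₀ hm1 x.ne_zero)
          · rw [truncSum_one]
            exact ih m
      _ ≤ _ := by
          simp only [truncSum, PNat.one_coe, pow_one, mul_one]
          refine Finset.sum_le_sum_of_subset_of_nonneg
            (Finset.Ioc_subset_Ioc_left (Nat.zero_le a)) fun m _ _ => ?_
          exact mul_nonneg (by positivity)
            (pow_nonneg (Finset.sum_nonneg fun _ _ => by positivity) _)

theorem truncSum_self (N : ℕ) (x : ℕ+) (k : List ℕ+) : truncSum N N (x :: k) = 0 := by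
  simp [truncSum]

/-- Splitting off the terms whose largest index is `N + 1`. -/
theorem truncSum_succ (N : ℕ) (x : ℕ+) (k : List ℕ+) : ∀ a ≤ N,
    truncSum (N + 1) a (k ++ [x]) =
      truncSum N a (k ++ [x]) + truncSum N a k / ((N : ℝ) + 1) ^ (x : ℕ) := by
  induction k with
  | nil =>
    intro a ha
    simp only [List.nil_append, truncSum, mul_one]
    rw [← Finset.insert_Ioc_right_eq_Ioc_add_one ha, Finset.sum_insert (by simp)]
    push_cast
    ring
  | cons y k ih =>
    intro a ha
    simp only [List.cons_append, truncSum]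
    rw [← Finset.insert_Ioc_right_eq_Ioc_add_one ha, Finset.sum_insert (by simp)]
    have h0 : truncSum (N + 1) (N + 1) (k ++ [x]) = 0 := by
      cases k <;> simp [truncSum]
    rw [h0, mul_zero, zero_add, Finset.sum_div, ← Finset.sum_add_distrib]
    refine Finset.sum_congr rfl fun m hm => ?_
    rw [ih m (Finset.mem_Ioc.1 hm).2]
    ring

/-- The admissible case: the truncated sums converge, with a power saving. -/
theorem negligible_admissible (k : List ℕ+) (x : ℕ+) (hx : x ≠ 1) :
    ∃ c : ℝ, Negligible (fun N => truncSum N 0 (k ++ [x]) - c) := by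
  have hx2 : 2 ≤ (x : ℕ) := by
    have h1 : (x : ℕ) ≠ 1 := fun h => hx (PNat.coe_eq_one_iff.1 h)
    have := x.pos
    omega
  -- growth of the inner sums
  obtain ⟨M, hM1, hM⟩ : ∃ M : ℕ, 1 ≤ M ∧ ∀ N ≥ M, truncSum N 0 k ≤ (N : ℝ) ^ (1 / 2 : ℝ) := by
    have h1 : ∀ᶠ t : ℝ in atTop, (1 + t) ^ k.length ≤ Real.exp (1 / 2 * t) := by
      have h2 := tendsto_rpow_mul_exp_neg_mul_atTop_nhds_zero (k.length : ℝ) (1 / 2)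
        (by norm_num)
      have h3 := (h2.comp (tendsto_atTop_add_const_left atTop (1 : ℝ) tendsto_id)).eventually
        (gt_mem_nhds (Real.exp_pos (-(1 / 2))))
      filter_upwards [h3] with t ht
      simp only [Function.comp, id, Real.rpow_natCast] at ht
      have h4 : Real.exp (-(1 / 2)) = Real.exp (-(1 / 2) * (1 + t)) * Real.exp (1 / 2 * t) := by
        rw [← Real.exp_add]
        congr 1
        ring
      rw [h4, mul_comm] at ht
      exact (lt_of_mul_lt_mul_left ht (Real.exp_pos _).le).le
    have h5 := (Real.tendsto_log_atTop.comp tendsto_natCast_atTop_atTop).eventually h1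
    obtain ⟨M, hM⟩ := eventually_atTop.1 (h5.and (eventually_ge_atTop 1))
    refine ⟨max M 1, le_max_right _ _, fun N hN => ?_⟩
    obtain ⟨h6, h7⟩ := hM N (le_trans (le_max_left _ _) hN)
    have hN' : (0 : ℝ) < N := by exact_mod_cast h7
    calc truncSum N 0 k ≤ (harmonic N : ℝ) ^ k.length := truncSum_le N k 0
      _ ≤ (1 + Real.log N) ^ k.length := by
          refine pow_le_pow_left₀ ?_ (harmonic_le_one_add_log N) _
          rw [← truncSum_one]
          exact truncSum_nonneg _ _ _
      _ ≤ Real.exp (1 / 2 * Real.log N) := h6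
      _ = (N : ℝ) ^ (1 / 2 : ℝ) := by rw [Real.rpow_def_of_pos hN', mul_comm]
  set S : ℕ → ℝ := fun N => truncSum N 0 (k ++ [x]) with hS
  have hmono : Monotone S := monotone_nat_of_le_succ fun N => by
    simp only [hS]
    rw [truncSum_succ N x k 0 (Nat.zero_le N)]
    have := truncSum_nonneg N k 0
    have : 0 ≤ truncSum N 0 k / ((N : ℝ) + 1) ^ (x : ℕ) := by positivity
    linarith
  -- `S N + 4 / √N` decreases
  have hstep : ∀ N ≥ M, S (N + 1) + 4 * ((N + 1 : ℕ) : ℝ) ^ (-(1 / 2) : ℝ)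
      ≤ S N + 4 * (N : ℝ) ^ (-(1 / 2) : ℝ) := by
    intro N hN
    have hN1 : (1 : ℝ) ≤ N := by exact_mod_cast le_trans hM1 hN
    have hN0 : (0 : ℝ) < N := by linarith
    have h1 : S (N + 1) = S N + truncSum N 0 k / ((N : ℝ) + 1) ^ (x : ℕ) :=
      truncSum_succ N x k 0 (Nat.zero_le N)
    have h2 : truncSum N 0 k / ((N : ℝ) + 1) ^ (x : ℕ) ≤ √(N : ℝ) / ((N : ℝ) + 1) ^ 2 := by
      have h3 := hM N hN
      rw [← Real.sqrt_eq_rpow] at h3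
      refine div_le_div₀ (Real.sqrt_nonneg _) h3 (by positivity) ?_
      exact pow_le_pow_right₀ (by linarith) hx2
    rw [h1, Real.rpow_neg hN0.le, Real.rpow_neg (Nat.cast_nonneg _), ← Real.sqrt_eq_rpow,
      ← Real.sqrt_eq_rpow]
    push_cast
    set s := √(N : ℝ)
    set t := √((N : ℝ) + 1)
    have hs : 0 < s := Real.sqrt_pos.2 hN0
    have ht : 0 < t := Real.sqrt_pos.2 (by linarith)
    have hs2 : s ^ 2 = N := Real.sq_sqrt hN0.le
    have ht2 : t ^ 2 = (N : ℝ) + 1 := Real.sq_sqrt (by linarith)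
    have hst : s ≤ t := Real.sqrt_le_sqrt (by linarith)
    have h4 : s / ((N : ℝ) + 1) ^ 2 + 4 * t⁻¹ ≤ 4 * s⁻¹ := by
      rw [← ht2]
      have h5 : 4 * s⁻¹ - (s / (t ^ 2) ^ 2 + 4 * t⁻¹)
          = (4 * (t - s) * t ^ 3 - s ^ 2) / (s * t ^ 4) := by
        field_simp
        ring
      have h6 : (t - s) * (t + s) = 1 := by nlinarith
      have h7 : 0 ≤ t - s := by linarith
      have h8 : s ^ 2 ≤ 4 * (t - s) * t ^ 3 := by
        have h9 : 1 ≤ (t - s) * (2 * t) := by nlinarith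
        have h10 : s ^ 2 ≤ t ^ 2 := by linarith
        nlinarith [sq_nonneg t]
      have h11 : 0 ≤ (4 * (t - s) * t ^ 3 - s ^ 2) / (s * t ^ 4) :=
        div_nonneg (by linarith) (by positivity)
      linarith
    linarith
  have hanti : ∀ N ≥ M, ∀ n ≥ N, S n + 4 * (n : ℝ) ^ (-(1 / 2) : ℝ)
      ≤ S N + 4 * (N : ℝ) ^ (-(1 / 2) : ℝ) := by
    intro N hN n hn
    induction n, hn using Nat.le_induction with
    | base => exact le_rfl
    | succ n hn ih => exact (hstep n (le_trans hN hn)).trans ih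
  have hle : ∀ N ≥ M, ∀ n, S n ≤ S N + 4 * (N : ℝ) ^ (-(1 / 2) : ℝ) := by
    intro N hN n
    have h1 := hanti N hN (max n N) (le_max_right _ _)
    have h2 := hmono (le_max_left n N)
    have h3 : (0 : ℝ) ≤ ((max n N : ℕ) : ℝ) ^ (-(1 / 2) : ℝ) := by positivity
    linarith
  have hbdd : BddAbove (Set.range S) := ⟨_, by
    rintro _ ⟨n, rfl⟩
    exact hle M le_rfl n⟩
  refine ⟨⨆ n, S n, negligible_of_le 4 ?_⟩
  filter_upwards [eventually_ge_atTop M] with N hN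
  rw [abs_le]
  have h1 : S N ≤ ⨆ n, S n := le_ciSup hbdd N
  have h2 : ⨆ n, S n ≤ S N + 4 * (N : ℝ) ^ (-(1 / 2) : ℝ) := ciSup_le (hle N hN)
  have h3 : (0 : ℝ) ≤ (N : ℝ) ^ (-(1 / 2) : ℝ) := by positivity
  constructor <;> linarith

theorem hasExpansion_admissible (k : List ℕ+) (x : ℕ+) (hx : x ≠ 1) :
    HasExpansion (fun N => truncSum N 0 (k ++ [x])) := by
  obtain ⟨c, hc⟩ := negligible_admissible k x hx
  exact ⟨Polynomial.C c, by simpa using hc⟩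

theorem tendsto_truncSum_admissible (k : List ℕ+) (x : ℕ+) (hx : x ≠ 1) :
    ∃ c : ℝ, Tendsto (fun N => truncSum N 0 (k ++ [x])) atTop (𝓝 c) := by
  obtain ⟨c, hc⟩ := negligible_admissible k x hx
  refine ⟨c, ?_⟩
  have h := (hc 0).add_const c
  simpa using h

/-- The words that occur in the stuffle product of the one-letter word `1` with a given word. -/
def stuffleOne : List ℕ+ → List (List ℕ+)
  | [] => [[1]]
  | x :: k => (1 :: x :: k) :: ((x + 1) :: k) :: (stuffleOne k).map (x :: ·)

theorem truncSum_one_mul (N : ℕ) (k : List ℕ+) : ∀ a,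
    truncSum N a [1] * truncSum N a k = ((stuffleOne k).map (truncSum N a)).sum := by
  induction k with
  | nil => intro a; simp [stuffleOne, truncSum]
  | cons x k ih =>
    intro a
    have hmap : ((stuffleOne k).map fun v => truncSum N a (x :: v)).sum =
        ∑ m ∈ Finset.Ioc a N, 1 / (m : ℝ) ^ (x : ℕ) * ((stuffleOne k).map (truncSum N m)).sum := by
      simp only [truncSum]
      generalize stuffleOne k = l
      induction l with
      | nil => simp
      | cons v l ih' => simp only [List.map_cons, List.sum_cons, ih', mul_add, Finset.sum_add_distrib]
    rw [stuffleOne, List.map_cons, List.map_cons, List.sum_cons, List.sum_cons, List.map_map]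
    change _ = _ + (_ + ((stuffleOne k).map fun v => truncSum N a (x :: v)).sum)
    rw [hmap]
    simp only [← ih, truncSum, PNat.one_coe, pow_one, mul_one, PNat.add_coe]
    rw [← Finset.sum_add_distrib, Finset.sum_mul_sum]
    -- split according to `m < n`, `m = n`, `m > n`
    have key : ∀ f g : ℕ → ℝ, ∑ m ∈ Finset.Ioc a N, ∑ n ∈ Finset.Ioc a N, f m * g n =
        ∑ m ∈ Finset.Ioc a N, f m * ∑ n ∈ Finset.Ioc m N, g n +
        ∑ n ∈ Finset.Ioc a N, (f n * g n + g n * ∑ m ∈ Finset.Ioc n N, f m) := by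
      intro f g
      have hswap : ∑ n ∈ Finset.Ioc a N, g n * ∑ m ∈ Finset.Ioc n N, f m =
          ∑ m ∈ Finset.Ioc a N, ∑ n ∈ Finset.Ioo a m, f m * g n := by
        simp_rw [Finset.mul_sum]
        rw [Finset.sum_comm' (t' := Finset.Ioc a N) (s' := fun m => Finset.Ioo a m)]
        · exact Finset.sum_congr rfl fun m _ => Finset.sum_congr rfl fun n _ => mul_comm _ _
        · intro n m
          simp only [Finset.mem_Ioc, Finset.mem_Ioo]
          omega
      rw [Finset.sum_add_distrib, hswap, ← Finset.sum_add_distrib, ← Finset.sum_add_distrib]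
      refine Finset.sum_congr rfl fun m hm => ?_
      have hm' := Finset.mem_Ioc.1 hm
      have hU : Finset.Ioc a N = Finset.Ioc m N ∪ insert m (Finset.Ioo a m) := by
        ext n
        simp only [Finset.mem_Ioc, Finset.mem_union, Finset.mem_insert, Finset.mem_Ioo]
        omega
      have hD : Disjoint (Finset.Ioc m N) (insert m (Finset.Ioo a m)) := by
        rw [Finset.disjoint_left]
        intro n
        simp only [Finset.mem_Ioc, Finset.mem_insert, Finset.mem_Ioo]
        omega
      rw [hU, Finset.sum_union hD, Finset.sum_insert (by simp), Finset.mul_sum]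
    rw [key]
    congr 1
    refine Finset.sum_congr rfl fun m hm => ?_
    have hm0 : (m : ℝ) ≠ 0 := by
      have := (Finset.mem_Ioc.1 hm).1
      exact_mod_cast (by omega : m ≠ 0)
    rw [pow_succ]
    field_simp

/-- Words in which the last letter different from `1` exists and is followed by at most
`n` letters. -/
def TailLE (n : ℕ) (w : List ℕ+) : Prop :=
  ∃ (u : List ℕ+) (x : ℕ+) (m : ℕ), x ≠ 1 ∧ m ≤ n ∧ w = u ++ x :: List.replicate m 1

theorem TailLE.cons {n : ℕ} {w : List ℕ+} (y : ℕ+) (h : TailLE n w) : TailLE n (y :: w) := by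
  obtain ⟨u, x, m, hx, hm, rfl⟩ := h
  exact ⟨y :: u, x, m, hx, hm, rfl⟩

theorem add_one_ne_one (x : ℕ+) : x + 1 ≠ 1 := by
  intro h
  have := congrArg PNat.val h
  have := x.pos
  simp at *

theorem stuffleOne_replicate (n : ℕ) : ∃ l : List (List ℕ+), (∀ v ∈ l, TailLE n v) ∧
    ∀ G : List ℕ+ → ℝ, ((stuffleOne (List.replicate n 1)).map G).sum =
      ((n : ℝ) + 1) * G (List.replicate (n + 1) 1) + (l.map G).sum := by
  induction n with
  | zero => exact ⟨[], by simp, fun G => by simp [stuffleOne]⟩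
  | succ n ih =>
    obtain ⟨l, hl, hG⟩ := ih
    refine ⟨((1 + 1) :: List.replicate n 1) :: l.map (1 :: ·), ?_, fun G => ?_⟩
    · intro v hv
      rcases List.mem_cons.1 hv with rfl | hv
      · exact ⟨[], 1 + 1, n, add_one_ne_one 1, by omega, rfl⟩
      · obtain ⟨w, hw, rfl⟩ := List.mem_map.1 hv
        obtain ⟨u, x, m, hx, hm, rfl⟩ := hl w hw
        exact ⟨1 :: u, x, m, hx, by omega, rfl⟩
    · have h := hG fun v => G (1 :: v)
      rw [List.replicate_succ, stuffleOne]
      simp only [List.map_cons, List.sum_cons, List.map_map, Function.comp_def]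
      rw [h]
      simp only [← List.replicate_succ]
      push_cast
      ring

theorem stuffleOne_tail (u : List ℕ+) (x : ℕ+) (hx : x ≠ 1) (n : ℕ) :
    ∃ l : List (List ℕ+), (∀ v ∈ l, TailLE n v) ∧
    ∀ G : List ℕ+ → ℝ, ((stuffleOne (u ++ x :: List.replicate n 1)).map G).sum =
      ((n : ℝ) + 1) * G (u ++ x :: List.replicate (n + 1) 1) + (l.map G).sum := by
  induction u with
  | nil =>
    obtain ⟨l, hl, hG⟩ := stuffleOne_replicate n
    refine ⟨(1 :: x :: List.replicate n 1) :: ((x + 1) :: List.replicate n 1) ::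
      l.map (x :: ·), ?_, fun G => ?_⟩
    · intro v hv
      rcases List.mem_cons.1 hv with rfl | hv
      · exact ⟨[1], x, n, hx, le_rfl, rfl⟩
      rcases List.mem_cons.1 hv with rfl | hv
      · exact ⟨[], x + 1, n, add_one_ne_one x, le_rfl, rfl⟩
      · obtain ⟨w, hw, rfl⟩ := List.mem_map.1 hv
        exact (hl w hw).cons x
    · have h := hG fun v => G (x :: v)
      rw [List.nil_append, List.nil_append, stuffleOne]
      simp only [List.map_cons, List.sum_cons, List.map_map, Function.comp_def]
      rw [h]
      ring
  | cons y u ih =>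
    obtain ⟨l, hl, hG⟩ := ih
    refine ⟨(1 :: y :: (u ++ x :: List.replicate n 1)) ::
      ((y + 1) :: (u ++ x :: List.replicate n 1)) :: l.map (y :: ·), ?_, fun G => ?_⟩
    · intro v hv
      rcases List.mem_cons.1 hv with rfl | hv
      · exact ⟨1 :: y :: u, x, n, hx, le_rfl, rfl⟩
      rcases List.mem_cons.1 hv with rfl | hv
      · exact ⟨(y + 1) :: u, x, n, hx, le_rfl, rfl⟩
      · obtain ⟨w, hw, rfl⟩ := List.mem_map.1 hv
        exact (hl w hw).cons y
    · have h := hG fun v => G (y :: v)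
      rw [List.cons_append, List.cons_append, stuffleOne]
      simp only [List.map_cons, List.sum_cons, List.map_map, Function.comp_def]
      rw [h]
      ring

theorem HasExpansion.step {w w' : List ℕ+} {n : ℕ} {l : List (List ℕ+)}
    (hw : HasExpansion fun N => truncSum N 0 w)
    (hl : ∀ v ∈ l, HasExpansion fun N => truncSum N 0 v)
    (hG : ∀ G : List ℕ+ → ℝ, ((stuffleOne w).map G).sum =
      ((n : ℝ) + 1) * G w' + (l.map G).sum) :
    HasExpansion fun N => truncSum N 0 w' := by
  have h1 := HasExpansion.list_sum (F := fun v N => truncSum N 0 v) l hl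
  have h2 := ((hasExpansion_one.mul hw).add (h1.const_mul (-1))).const_mul (((n : ℝ) + 1)⁻¹)
  convert h2 using 2 with N
  have hn : (n : ℝ) + 1 ≠ 0 := by positivity
  rw [truncSum_one_mul, hG (truncSum N 0)]
  field_simp
  ring

theorem hasExpansion_tail (n : ℕ) : ∀ w : List ℕ+, TailLE n w →
    HasExpansion fun N => truncSum N 0 w := by
  induction n with
  | zero =>
    rintro w ⟨u, x, m, hx, hm, rfl⟩
    obtain rfl : m = 0 := by omega
    exact hasExpansion_admissible u x hx
  | succ n ih =>
    rintro w ⟨u, x, m, hx, hm, rfl⟩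
    rcases Nat.lt_or_ge n m with h | h
    · obtain rfl : m = n + 1 := by omega
      obtain ⟨l, hl, hG⟩ := stuffleOne_tail u x hx n
      exact HasExpansion.step (ih _ ⟨u, x, n, hx, le_rfl, rfl⟩) (fun v hv => ih v (hl v hv)) hG
    · exact ih _ ⟨u, x, m, hx, h, rfl⟩

theorem hasExpansion_replicate (n : ℕ) :
    HasExpansion fun N => truncSum N 0 (List.replicate n 1) := by
  induction n with
  | zero => simpa [truncSum] using hasExpansion_const 1
  | succ n ih =>
    obtain ⟨l, hl, hG⟩ := stuffleOne_replicate n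
    exact HasExpansion.step ih (fun v hv => hasExpansion_tail n v (hl v hv)) hG

theorem word_cases (w : List ℕ+) : (∃ n, w = List.replicate n 1) ∨ ∃ n, TailLE n w := by
  induction w with
  | nil => exact Or.inl ⟨0, rfl⟩
  | cons y w ih =>
    rcases ih with ⟨n, rfl⟩ | ⟨n, h⟩
    · by_cases hy : y = 1
      · exact Or.inl ⟨n + 1, by rw [hy, List.replicate_succ]⟩
      · exact Or.inr ⟨n, [], y, n, hy, le_rfl, rfl⟩
    · exact Or.inr ⟨n, h.cons y⟩

theorem hasExpansion_truncSum (k : List ℕ+) : HasExpansion fun N => truncSum N 0 k := by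
  rcases word_cases k with ⟨n, rfl⟩ | ⟨n, h⟩
  · exact hasExpansion_replicate n
  · exact hasExpansion_tail n k h

theorem eq_zero_of_tendsto {R : Polynomial ℝ}
    (h1 : Tendsto (fun N : ℕ => R.eval (logGamma N)) atTop (𝓝 0)) : R = 0 := by
  rcases lt_or_ge 0 R.degree with hd | hd
  · have h2 := (R.abs_tendsto_atTop hd).comp tendsto_logGamma
    exact absurd h1.abs (not_tendsto_nhds_of_tendsto_atTop h2 _)
  · obtain ⟨c, rfl⟩ : ∃ c, R = Polynomial.C c := ⟨_, Polynomial.eq_C_of_degree_le_zero hd⟩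
    simp only [Polynomial.eval_C] at h1
    rw [tendsto_nhds_unique tendsto_const_nhds h1, Polynomial.C_0]

theorem existsUnique_isRegPoly (k : List ℕ+) : ∃! P : Polynomial ℝ, IsRegPoly k P := by
  obtain ⟨P, hP⟩ := hasExpansion_truncSum k
  have hP0 : IsRegPoly k P := by simpa [IsRegPoly, logGamma] using hP 0
  refine ⟨P, hP0, fun Q hQ => ?_⟩
  refine sub_eq_zero.1 (eq_zero_of_tendsto ?_)
  have h := Tendsto.sub hP0 hQ
  rw [sub_zero] at h
  refine h.congr fun N => ?_
  rw [Polynomial.eval_sub, logGamma]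
  ring

/-! ### The regularized values -/

/-- The stuffle regularization polynomial `Z(k₁, …, k_d; T)`. It is the constant
`ζ(k₁, …, k_d)` if `k_d ≥ 2`, it is `T` for the index `(1)`, and it is multiplicative for the
stuffle product, because the truncated sums are. -/
noncomputable def regPoly (k : List ℕ+) : Polynomial ℝ := (existsUnique_isRegPoly k).choose

/-- The stuffle regularized multiple zeta value `ζ^*(k₁, …, k_d)`, normalized by
`ζ^*(1) = 0`; its value at the empty index is `1`. -/
noncomputable def zetaReg (k : List ℕ+) : ℝ := (regPoly k).eval 0

theorem isRegPoly_regPoly (k : List ℕ+) : IsRegPoly k (regPoly k) :=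
  (existsUnique_isRegPoly k).choose_spec.1

theorem IsRegPoly.eq_regPoly {k : List ℕ+} {P : Polynomial ℝ} (h : IsRegPoly k P) :
    P = regPoly k :=
  (existsUnique_isRegPoly k).unique h (isRegPoly_regPoly k)

/-- If the last entry is at least `2`, then `ζ^*` is the convergent multiple zeta value. -/
theorem tendsto_truncSum_zetaReg (k : List ℕ+) (x : ℕ+) (hx : x ≠ 1) :
    Tendsto (fun N => truncSum N 0 (k ++ [x])) atTop (𝓝 (zetaReg (k ++ [x]))) := by
  obtain ⟨c, hc⟩ := tendsto_truncSum_admissible k x hx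
  have h : IsRegPoly (k ++ [x]) (Polynomial.C c) := by
    simpa [IsRegPoly] using hc.sub_const c
  rw [zetaReg, ← h.eq_regPoly, Polynomial.eval_C]
  exact hc

theorem zetaReg_nil : zetaReg [] = 1 := by
  have h : IsRegPoly [] (Polynomial.C 1) := by simp [IsRegPoly, truncSum]
  rw [zetaReg, ← h.eq_regPoly, Polynomial.eval_C]

theorem regPoly_one : regPoly [1] = Polynomial.X := by
  symm
  apply IsRegPoly.eq_regPoly
  have h := Real.tendsto_harmonic_sub_log.sub_const Real.eulerMascheroniConstant
  rw [sub_self] at h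
  refine h.congr fun N => ?_
  rw [truncSum_one, Polynomial.eval_X]
  ring

theorem zetaReg_one : zetaReg [1] = 0 := by
  rw [zetaReg, regPoly_one, Polynomial.eval_X]

/-- The stuffle product of `1` with any index is respected. Together with the values at
admissible indices and `ζ^*(1) = 0` this determines `ζ^*`. -/
theorem sum_zetaReg_stuffleOne (k : List ℕ+) : ((stuffleOne k).map zetaReg).sum = 0 := by
  obtain ⟨P, hP⟩ := hasExpansion_truncSum k
  obtain ⟨Q, hQ⟩ := hasExpansion_one
  have hsum : ∀ l : List (List ℕ+), Tendsto (fun N : ℕ => (l.map (truncSum N 0)).sum -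
      ((l.map regPoly).sum).eval (logGamma N)) atTop (𝓝 0) := by
    intro l
    induction l with
    | nil => simp
    | cons v l ih =>
      have h := Tendsto.add (isRegPoly_regPoly v) ih
      rw [add_zero] at h
      refine h.congr fun N => ?_
      simp only [List.map_cons, List.sum_cons, Polynomial.eval_add, logGamma]
      ring
  have hQX : Q = Polynomial.X := by
    rw [← regPoly_one]
    apply IsRegPoly.eq_regPoly
    simpa [IsRegPoly, logGamma] using hQ 0
  have hprod := ((hP.mul_eval Q).add (hQ.mul_eval P)).add (hP.mul hQ) 0
  have hzero : Tendsto (fun N : ℕ =>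
      (Q * P - ((stuffleOne k).map regPoly).sum).eval (logGamma N)) atTop (𝓝 0) := by
    have h := (hsum (stuffleOne k)).sub hprod
    rw [sub_zero] at h
    refine h.congr fun N => ?_
    rw [← truncSum_one_mul, Polynomial.eval_sub, Polynomial.eval_mul]
    ring
  have heq := sub_eq_zero.1 (eq_zero_of_tendsto hzero)
  have h2 : ∀ l : List (List ℕ+), (l.map zetaReg).sum = ((l.map regPoly).sum).eval 0 := by
    intro l
    induction l with
    | nil => simp
    | cons v l ih => simp [ih, zetaReg]
  rw [h2, ← heq, hQX]
  simp

/-- All the indices `x □ k₁ □ ⋯ □ k_d` where each `□` is a comma or a plus sign. -/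
def mergingsFrom : ℕ+ → List ℕ+ → List (List ℕ+)
  | x, [] => [[x]]
  | x, y :: k => (mergingsFrom y k).map (x :: ·) ++ mergingsFrom (x + y) k

/-- All the indices `k₁ □ ⋯ □ k_d` where each `□` is a comma or a plus sign. -/
def mergings : List ℕ+ → List (List ℕ+)
  | [] => [[]]
  | x :: k => mergingsFrom x k

/-- The stuffle regularized multiple zeta star value `ζ^{⋆,*}(k₁, …, k_d)`. -/
noncomputable def zetaStarReg (k : List ℕ+) : ℝ := ((mergings k).map zetaReg).sum

/-- `ζ_a^*(k₁, …, k_d)`, the sum of `(-1)^a ∏ⱼ (kⱼ - 1 + aⱼ choose aⱼ) ζ^*(k₁ + a₁, …, k_d + a_d)`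
over `a₁ + ⋯ + a_d = a`. Here `(kⱼ - 1 + aⱼ).succPNat` is `kⱼ + aⱼ`. -/
noncomputable def zetaTaylor (a : ℕ) (k : List ℕ+) : ℝ :=
  (-1) ^ a * ∑ α ∈ Finset.Nat.antidiagonalTuple k.length a,
    zetaReg (List.ofFn fun j => Nat.succPNat ((k.get j : ℕ) - 1 + α j)) *
      ∏ j, ((((k.get j : ℕ) - 1 + α j).choose (α j) : ℕ) : ℝ)

/-- `δ^{k₁, …, k_d}`: it is `(-1)^n π^(2n) / (2n)!` if the index is `(1, …, 1)` of length `2n`,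
and `0` otherwise. -/
noncomputable def deltaTerm (k : List ℕ+) : ℝ :=
  if Even k.length ∧ k = List.replicate k.length 1 then
    (-1) ^ (k.length / 2) * Real.pi ^ k.length / (k.length.factorial : ℝ)
  else 0

/-- The weight `k₁ + ⋯ + k_d`. -/
def weight (k : List ℕ+) : ℕ := (k.map fun x => (x : ℕ)).sum

/-- The triples `(a, m, b)` of natural numbers with `a + 2m + b = n`. -/
def triples (n : ℕ) : Finset (ℕ × ℕ × ℕ) :=
  (Finset.range (n + 1) ×ˢ Finset.range (n + 1) ×ˢ Finset.range (n + 1)).filter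
    fun t => t.1 + 2 * t.2.1 + t.2.2 = n

end MZV

/-!
The multitangent function of `k` is the sum of `1 / ((z + n₁) ^ k₁ ⋯ (z + n_d) ^ k_d)` over all
integers `n₁ < ⋯ < n_d`, regularized through multiple Hurwitz zeta functions; it has period `1`.
Splitting the integers into the negative ones, `0` and the positive ones expresses it through
functions that are holomorphic on the strip `|re z| < 1` and whose Taylor coefficients at `0` are,
up to sign, the values `ζ_a^*`. Subtracting the combination of monotangent functions with the same
principal part at `0` leaves a periodic entire function of slow growth, hence a constant. The
behaviour at `± i ∞`, where only the indices `(1, …, 1)` contribute, identifies this constant as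
`δ(k)`, while at `0` it is the symmetric sum
`∑ᵢ (-1) ^ (k₁ + ⋯ + kᵢ) ζ^*(kᵢ, …, k₁) ζ^*(kᵢ₊₁, …, k_d)` plus products of the `ζ_a^*` with the
constant terms of the monotangent functions, which are even zeta values. Finally, up to signs the
star values invert the ordinary ones under deconcatenation, so that convolving with them recovers
`ζ^*(k)` from the symmetric sums; for `k₁ + ⋯ + k_d ≢ d` modulo `2`, the term with the empty `δ`
is then `-ζ^{⋆,*}(k)`.
-/

namespace MZV

open Finset.HasAntidiagonal

/-! ### Deconcatenation convolution -/

section Convolution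

variable {α R : Type*}

section Semiring

variable [Semiring R]

/-- The deconcatenation convolution `∑ f u * g v` over all factorizations `k = u ++ v`, which turns
functions on words into an algebra with unit `convUnit`. -/
def conv (f g : List α → R) (k : List α) : R :=
  ∑ i ∈ Finset.range (k.length + 1), f (k.take i) * g (k.drop i)

/-- The unit for `conv`: the indicator function of the empty word. -/
def convUnit : List α → R
  | [] => 1
  | _ :: _ => 0

/-- The function `1 + u` on words, where `u` is extended by zero from letters to words. -/
def letterFun (u : α → R) : List α → R
  | [] => 1
  | [x] => u x
  | _ :: _ :: _ => 0

theorem conv_nil (f g : List α → R) : conv f g [] = f [] * g [] := by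
  simp [conv]

theorem conv_cons (f g : List α → R) (x : α) (k : List α) :
    conv f g (x :: k) = f [] * g (x :: k) + conv (fun l => f (x :: l)) g k := by
  rw [conv, List.length_cons, Finset.sum_range_succ', add_comm]
  rfl

theorem conv_append_singleton (f g : List α → R) (k : List α) (x : α) :
    conv f g (k ++ [x]) = conv f (fun l => g (l ++ [x])) k + f (k ++ [x]) * g [] := by
  induction k generalizing f with
  | nil => simp [conv_nil, conv_cons]
  | cons y k ih => simp [conv_cons, ih, add_assoc]

theorem conv_add_left (f f' g : List α → R) (k : List α) :
    conv (fun l => f l + f' l) g k = conv f g k + conv f' g k := by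
  simp only [conv, add_mul, Finset.sum_add_distrib]

theorem conv_mul_left (c : R) (f g : List α → R) (k : List α) :
    conv (fun l => c * f l) g k = c * conv f g k := by
  simp only [conv, mul_assoc, Finset.mul_sum]

theorem conv_mul_right (f g : List α → R) (c : R) (k : List α) :
    conv f (fun l => g l * c) k = conv f g k * c := by
  simp only [conv, ← mul_assoc, Finset.sum_mul]

theorem conv_assoc (f g h : List α → R) : conv (conv f g) h = conv f (conv g h) := by
  funext k
  induction k generalizing f g with
  | nil => simp only [conv_nil, mul_assoc]
  | cons x k ih =>
    have hcons : (fun l => conv f g (x :: l)) =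
        fun l => f [] * g (x :: l) + conv (fun l => f (x :: l)) g l :=
      funext fun l => conv_cons f g x l
    rw [conv_cons, hcons, conv_add_left, conv_mul_left, ih, conv_cons, conv_cons, conv_nil]
    simp only [mul_add, mul_assoc, add_assoc]

theorem convUnit_reverse (k : List α) : (convUnit k.reverse : R) = convUnit k := by
  induction k using List.reverseRecOn with
  | nil => rfl
  | append_singleton k x _ => cases k <;> simp [convUnit]

theorem conv_unit_left (g : List α → R) : conv convUnit g = g := by
  funext k
  cases k with
  | nil => simp [conv_nil, convUnit]
  | cons x k => simp [conv, convUnit, Finset.sum_range_succ' _ (k.length + 1)]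

theorem conv_unit_right (f : List α → R) : conv f convUnit = f := by
  funext k
  induction k using List.reverseRecOn with
  | nil => simp [conv_nil, convUnit]
  | append_singleton k x _ =>
    have hunit : (fun l : List α => (convUnit (l ++ [x]) : R)) = fun _ => 0 :=
      funext fun l => by cases l <;> rfl
    rw [conv_append_singleton, hunit, convUnit, mul_one, conv]
    simp only [mul_zero, Finset.sum_const_zero, zero_add]

theorem conv_letterFun_cons (u : α → R) (g : List α → R) (x : α) (k : List α) :
    conv (letterFun u) g (x :: k) = g (x :: k) + u x * g k := by
  have hletter : (fun l : List α => letterFun u (x :: l)) = fun l => u x * convUnit l :=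
    funext fun l => by cases l <;> simp [letterFun, convUnit]
  rw [conv_cons, hletter, conv_mul_left, conv_unit_left, letterFun, one_mul]

theorem conv_letterFun_left_cancel {u : α → R} {g h : List α → R} [IsRightCancelAdd R]
    (hgh : conv (letterFun u) g = conv (letterFun u) h) : g = h := by
  funext k
  induction k with
  | nil => simpa [conv_nil, letterFun] using congrFun hgh []
  | cons x k ih =>
    have hcons := congrFun hgh (x :: k)
    rw [conv_letterFun_cons, conv_letterFun_cons, ih] at hcons
    exact add_right_cancel hcons

theorem conv_letterFun_append (u : α → R) (f : List α → R) (x : α) (k : List α) :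
    conv f (letterFun u) (k ++ [x]) = f (k ++ [x]) + f k * u x := by
  have hletter : (fun l : List α => letterFun u (l ++ [x])) = fun l => convUnit l * u x :=
    funext fun l => by rcases l with _ | ⟨y, _ | ⟨z, l⟩⟩ <;> simp [letterFun, convUnit]
  rw [conv_append_singleton, hletter, conv_mul_right, conv_unit_right, letterFun, mul_one, add_comm]

theorem conv_letterFun_middle (u : α → R) (f g : List α → R) (k : List α) :
    conv f (conv (letterFun u) g) k = conv f g k +
      ∑ j : Fin k.length, f (k.take j) * u (k.get j) * g (k.drop (j + 1)) := by
  induction k generalizing f with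
  | nil => simp [conv_nil, letterFun]
  | cons x k ih =>
    have hsum := Fin.sum_univ_succ (n := k.length) fun j : Fin (k.length + 1) =>
      f ((x :: k).take j) * u ((x :: k).get j) * g ((x :: k).drop (j + 1))
    simp only [List.length_cons]
    rw [hsum, conv_cons, ih, conv_letterFun_cons, conv_cons, mul_add, ← mul_assoc]
    simp only [Fin.val_zero, List.take_zero, List.get_cons_zero, zero_add, List.drop_succ_cons,
      List.drop_zero, Fin.val_succ, List.take_succ_cons]
    abel

theorem conv_sum_middle (f : List α → R) (g : List α → α → List α → R)
    (k : List α) :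
    conv f (fun l => ∑ j : Fin l.length, g (l.take j) (l.get j) (l.drop (j + 1))) k =
      ∑ j : Fin k.length, conv f (fun l => g l (k.get j) (k.drop (j + 1))) (k.take j) := by
  induction k generalizing f with
  | nil => simp [conv_nil]
  | cons x k ih =>
    have hsum := Fin.sum_univ_succ (n := k.length) fun j : Fin (k.length + 1) =>
      conv f (fun l => g l ((x :: k).get j) ((x :: k).drop (j + 1))) ((x :: k).take j)
    rw [conv_cons, ih]
    simp only [List.length_cons]
    rw [hsum, Fin.sum_univ_succ]
    simp only [Fin.val_zero, List.take_zero, List.get_cons_zero, zero_add, List.drop_succ_cons,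
      List.drop_zero, Fin.val_succ, List.take_succ_cons, conv_nil, conv_cons,
      Finset.sum_add_distrib, mul_add, Finset.mul_sum]
    exact add_assoc _ _ _

end Semiring

theorem conv_mul_mul [CommSemiring R] {c : List α → R} (hc : ∀ u v, c (u ++ v) = c u * c v)
    (f g : List α → R) (k : List α) :
    conv (fun l => c l * f l) (fun l => c l * g l) k = c k * conv f g k := by
  rw [conv, conv, Finset.mul_sum]
  refine Finset.sum_congr rfl fun i _ => ?_
  rw [mul_mul_mul_comm, ← hc, List.take_append_drop]

theorem conv_pow_div_factorial {K : Type*} [Field K] [CharZero K] (a b : K) (k : List α) :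
    conv (fun l => a ^ l.length / (l.length.factorial : K))
      (fun l => b ^ l.length / (l.length.factorial : K)) k =
      (a + b) ^ k.length / (k.length.factorial : K) := by
  rw [conv, add_pow, Finset.sum_div]
  refine Finset.sum_congr rfl fun i hi => ?_
  have hi' : i ≤ k.length := Nat.lt_succ_iff.1 (Finset.mem_range.1 hi)
  have hfact : (k.length.factorial : K) ≠ 0 := Nat.cast_ne_zero.2 k.length.factorial_ne_zero
  rw [List.length_take, List.length_drop, min_eq_left hi', Nat.cast_choose K hi']
  field_simp

end Convolution

/-! ### Orders of growth -/

section HasOrderLE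

variable {E E' 𝕜 : Type*} [SeminormedAddCommGroup E] [SeminormedAddCommGroup E'] [NormedField 𝕜]
  {l l' : Filter E} {r s : ℝ} {f g : E → 𝕜}

/-- `f` has order at most `r` along `l`: it is `O((1 + ‖x‖) ^ (r + ε))` for every `ε > 0`. Such
orders are additive under products and do not see logarithmic factors. -/
def HasOrderLE (l : Filter E) (r : ℝ) (f : E → 𝕜) : Prop :=
  ∀ ε > 0, f =O[l] fun x => (1 + ‖x‖) ^ (r + ε)

theorem isBigO_one_add_norm_rpow (l : Filter E) (hrs : r ≤ s) :
    (fun x : E => (1 + ‖x‖) ^ r) =O[l] fun x => (1 + ‖x‖) ^ s :=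
  .of_norm_le fun x => by
    rw [Real.norm_of_nonneg (by positivity)]
    exact Real.rpow_le_rpow_of_exponent_le (le_add_of_nonneg_right (norm_nonneg x)) hrs

theorem hasOrderLE_of_isBigO (h : f =O[l] fun x => (1 + ‖x‖) ^ r) : HasOrderLE l r f :=
  fun _ε hε => h.trans (isBigO_one_add_norm_rpow l (le_add_of_nonneg_right hε.le))

theorem hasOrderLE_of_forall_le {δ : ℝ} (hδ : 0 < δ)
    (h : ∀ ε > 0, ε ≤ δ → f =O[l] fun x => (1 + ‖x‖) ^ (r + ε)) : HasOrderLE l r f := fun ε hε =>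
  (h (min ε δ) (lt_min hε hδ) (min_le_right ε δ)).trans
    (isBigO_one_add_norm_rpow l (by gcongr; exact min_le_left ε δ))

theorem hasOrderLE_const (l : Filter E) (c : 𝕜) : HasOrderLE l 0 fun _ => c :=
  hasOrderLE_of_isBigO <| by
    simpa using Asymptotics.isBigO_const_const c (one_ne_zero (α := ℝ)) l

theorem hasOrderLE_zero : HasOrderLE l r fun _ => (0 : 𝕜) :=
  fun _ _ => Asymptotics.isBigO_zero _ _

namespace HasOrderLE

theorem mono (hf : HasOrderLE l r f) (hrs : r ≤ s) : HasOrderLE l s f :=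
  fun ε hε => (hf ε hε).trans (isBigO_one_add_norm_rpow l (by gcongr))

theorem mono_filter (hf : HasOrderLE l r f) (h : l' ≤ l) : HasOrderLE l' r f :=
  fun ε hε => (hf ε hε).mono h

theorem congr (hf : HasOrderLE l r f) (h : ∀ x, f x = g x) : HasOrderLE l r g :=
  fun ε hε => (hf ε hε).congr_left h

theorem add (hf : HasOrderLE l r f) (hg : HasOrderLE l r g) :
    HasOrderLE l r fun x => f x + g x :=
  fun ε hε => (hf ε hε).add (hg ε hε)

theorem sub (hf : HasOrderLE l r f) (hg : HasOrderLE l r g) :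
    HasOrderLE l r fun x => f x - g x :=
  fun ε hε => (hf ε hε).sub (hg ε hε)

theorem const_mul (c : 𝕜) (hf : HasOrderLE l r f) : HasOrderLE l r fun x => c * f x :=
  fun ε hε => (hf ε hε).const_mul_left c

theorem mul (hf : HasOrderLE l r f) (hg : HasOrderLE l s g) :
    HasOrderLE l (r + s) fun x => f x * g x := fun ε hε => by
  refine ((hf (ε / 2) (half_pos hε)).mul (hg (ε / 2) (half_pos hε))).congr_right fun x => ?_
  rw [← Real.rpow_add (by positivity)]
  ring_nf

theorem pow (hf : HasOrderLE l 0 f) (n : ℕ) : HasOrderLE l 0 fun x => f x ^ n := by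
  induction n with
  | zero => simpa using hasOrderLE_const l (1 : 𝕜)
  | succ n ih => simpa [pow_succ] using ih.mul hf

theorem finset_sum {ι : Type*} (t : Finset ι) {F : ι → E → 𝕜}
    (hF : ∀ i ∈ t, HasOrderLE l r (F i)) : HasOrderLE l r fun x => ∑ i ∈ t, F i x :=
  fun ε hε => .fun_sum fun i hi => hF i hi ε hε

theorem comp_isometry {l' : Filter E'} {φ : E' → E} (hf : HasOrderLE l r f) (hφ : Isometry φ)
    (h : Tendsto φ l' l) : HasOrderLE l' r fun x => f (φ x) := fun ε hε => by
  have hnorm (x : E') : |‖φ x‖ - ‖x‖| ≤ ‖φ 0‖ := by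
    have hdist : ‖φ x - φ 0‖ = ‖x‖ := by simpa [dist_eq_norm] using hφ.dist_eq x 0
    have hlower := norm_sub_le (φ x) (φ 0)
    have hupper := norm_sub_norm_le (φ x) (φ 0)
    rw [abs_le]
    constructor <;> linarith
  have hle : (fun x => 1 + ‖φ x‖) =O[l'] fun x => 1 + ‖x‖ :=
    .of_bound (1 + ‖φ 0‖) <| .of_forall fun x => by
      rw [Real.norm_of_nonneg (by positivity), Real.norm_of_nonneg (by positivity)]
      nlinarith [abs_le.1 (hnorm x), norm_nonneg x, norm_nonneg (φ 0)]
  have hge : (fun x => 1 + ‖x‖) =O[l'] fun x => 1 + ‖φ x‖ :=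
    .of_bound (1 + ‖φ 0‖) <| .of_forall fun x => by
      rw [Real.norm_of_nonneg (by positivity), Real.norm_of_nonneg (by positivity)]
      nlinarith [abs_le.1 (hnorm x), norm_nonneg (φ x), norm_nonneg (φ 0)]
  exact ((hf ε hε).comp_tendsto h).trans
    ((Asymptotics.IsTheta.rpow (.of_forall fun x => by positivity)
      (.of_forall fun x => by positivity) ⟨hle, hge⟩).1)

theorem tendsto_zero (hf : HasOrderLE l r f) (hr : r < 0) :
    Tendsto f (l ⊓ Bornology.cobounded E) (𝓝 0) := by
  have hgauge : Tendsto (fun x : E => (1 + ‖x‖) ^ (r + -r / 2)) (l ⊓ Bornology.cobounded E)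
      (𝓝 0) := by
    rw [show r + -r / 2 = -(-r / 2) by ring]
    exact (tendsto_rpow_neg_atTop (by linarith)).comp
      (tendsto_atTop_add_const_left _ 1 (tendsto_norm_cobounded_atTop.mono_left inf_le_right))
  exact ((hf (-r / 2) (by linarith)).mono inf_le_left).trans_tendsto hgauge

end HasOrderLE

end HasOrderLE

/-- The half plane `1 / 2 ≤ Re w`, which contains `1 + z` and `1 - z` when `|Re z| ≤ 1 / 2`. -/
def halfPlane : Set ℂ := {w | 1 / 2 ≤ w.re}

/-- `g` has order at most `r` on `halfPlane`. -/
abbrev Grows (r : ℝ) (g : ℂ → ℂ) : Prop := HasOrderLE (𝓟 halfPlane) r g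

/-- The open right half plane. -/
def rightHalf : Set ℂ := {w | 0 < w.re}

theorem isOpen_rightHalf : IsOpen rightHalf := isOpen_lt continuous_const Complex.continuous_re

theorem mem_halfPlane {w : ℂ} : w ∈ halfPlane ↔ 1 / 2 ≤ w.re := .rfl

theorem mem_rightHalf {w : ℂ} : w ∈ rightHalf ↔ 0 < w.re := .rfl

theorem halfPlane_subset_rightHalf : halfPlane ⊆ rightHalf :=
  fun _w hw => mem_rightHalf.2 (one_half_pos.trans_le (mem_halfPlane.1 hw))

theorem half_le_norm {w : ℂ} (hw : w ∈ halfPlane) : 1 / 2 ≤ ‖w‖ := hw.trans (Complex.re_le_norm w)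

theorem add_ofReal_mem_rightHalf {w : ℂ} (hw : w ∈ rightHalf) {t : ℝ} (ht : 0 ≤ t) :
    w + t ∈ rightHalf := by
  rw [mem_rightHalf, Complex.add_re, Complex.ofReal_re]
  exact add_pos_of_pos_of_nonneg hw ht

theorem add_one_mem_rightHalf {w : ℂ} (hw : w ∈ rightHalf) : w + 1 ∈ rightHalf := by
  simpa using add_ofReal_mem_rightHalf hw zero_le_one

theorem add_one_mem_halfPlane {w : ℂ} (hw : w ∈ rightHalf) : w + 1 ∈ halfPlane := by
  rw [mem_halfPlane, Complex.add_re, Complex.one_re]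
  linarith [mem_rightHalf.1 hw]

theorem add_natCast_mem_halfPlane {w : ℂ} (hw : w ∈ halfPlane) (n : ℕ) : w + n ∈ halfPlane := by
  rw [mem_halfPlane, Complex.add_re, Complex.natCast_re]
  exact le_add_of_le_of_nonneg hw n.cast_nonneg

theorem ne_zero_of_mem_rightHalf {w : ℂ} (hw : w ∈ rightHalf) : w ≠ 0 := by
  rintro rfl
  exact lt_irrefl 0 (mem_rightHalf.1 hw)

theorem norm_le_norm_add_ofReal {w : ℂ} (hw : 0 ≤ w.re) {t : ℝ} (ht : 0 ≤ t) : ‖w‖ ≤ ‖w + t‖ := by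
  rw [← sq_le_sq₀ (norm_nonneg _) (norm_nonneg _), ← Complex.normSq_eq_norm_sq,
    ← Complex.normSq_eq_norm_sq, Complex.normSq_apply, Complex.normSq_apply]
  simp only [Complex.add_re, Complex.ofReal_re, Complex.add_im, Complex.ofReal_im, add_zero]
  nlinarith

theorem norm_inv_add_ofReal_le {w : ℂ} (hw : w ∈ rightHalf) {t : ℝ} (ht : 0 ≤ t) :
    ‖(w + t)⁻¹‖ ≤ ‖w⁻¹‖ := by
  rw [norm_inv, norm_inv]
  exact inv_anti₀ (norm_pos_iff.2 (ne_zero_of_mem_rightHalf hw)) (norm_le_norm_add_ofReal hw.le ht)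

theorem HasOrderLE.comp_add_one {r : ℝ} {g : ℂ → ℂ} (hg : Grows r g) :
    Grows r fun w => g (w + 1) :=
  hg.comp_isometry (isometry_add_right 1) <| tendsto_principal_principal.2 fun _w hw =>
    add_one_mem_halfPlane (halfPlane_subset_rightHalf hw)

theorem grows_inv_pow (n : ℕ) : Grows (-n) fun w => (w ^ n)⁻¹ := by
  refine hasOrderLE_of_isBigO (Asymptotics.isBigO_principal.2 ⟨3 ^ n, fun w hw => ?_⟩)
  have hnorm : 1 + ‖w‖ ≤ 3 * ‖w‖ := by linarith [half_le_norm hw]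
  have hpos : 0 < ‖w‖ := by linarith [half_le_norm hw]
  rw [norm_inv, norm_pow, Real.rpow_neg (by positivity), Real.rpow_natCast,
    Real.norm_of_nonneg (by positivity), ← div_eq_mul_inv, le_div_iff₀ (by positivity),
    inv_mul_le_iff₀ (by positivity), ← mul_pow, mul_comm]
  gcongr

theorem grows_log : Grows 0 Complex.log := by
  intro ε hε
  refine Asymptotics.isBigO_principal.2 ⟨1 / ε + 2 + Real.pi, fun w hw => ?_⟩
  have hpos : 0 < ‖w‖ := by linarith [half_le_norm hw]
  have hgauge : 1 ≤ (1 + ‖w‖) ^ ε := Real.one_le_rpow (by linarith) hε.le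
  have hlog_le : Real.log ‖w‖ ≤ 1 / ε * (1 + ‖w‖) ^ ε := by
    rw [one_div_mul_eq_div]
    exact (Real.log_le_rpow_div hpos.le hε).trans (by gcongr; linarith)
  have hle_log : -2 ≤ Real.log ‖w‖ := by
    have hinv : ‖w‖⁻¹ ≤ 2 := by simpa using inv_anti₀ one_half_pos (half_le_norm hw)
    linarith [Real.one_sub_inv_le_log_of_pos hpos]
  have habs : |Real.log ‖w‖| ≤ 1 / ε * (1 + ‖w‖) ^ ε + 2 := by
    have : 0 ≤ 1 / ε * (1 + ‖w‖) ^ ε := by positivity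
    rw [abs_le]
    constructor <;> linarith
  have hnorm := Complex.norm_le_abs_re_add_abs_im (Complex.log w)
  rw [Complex.log_re, Complex.log_im] at hnorm
  rw [zero_add, Real.norm_of_nonneg (by positivity)]
  nlinarith [Complex.abs_arg_le_pi w, Real.pi_pos]

theorem hasDerivWithinAt_log_add {w : ℂ} (hw : w ∈ rightHalf) {t : ℝ} (ht : 0 ≤ t) (s : Set ℝ) :
    HasDerivWithinAt (fun t : ℝ => Complex.log (w + t)) (w + t)⁻¹ s t := by
  have hadd : HasDerivAt (fun t : ℝ => w + (t : ℂ)) 1 t := Complex.ofRealCLM.hasDerivAt.const_add w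
  have hlog := hadd.clog_real (Or.inl (add_ofReal_mem_rightHalf hw ht))
  rw [one_div] at hlog
  exact hlog.hasDerivWithinAt

theorem norm_inv_sub_inv_add_le {w : ℂ} (hw : w ∈ rightHalf) {t : ℝ} (ht : t ∈ Set.Icc 0 1) :
    ‖w⁻¹ - (w + t)⁻¹‖ ≤ ‖(w ^ 2)⁻¹‖ := by
  have hw0 := ne_zero_of_mem_rightHalf hw
  have hwt := ne_zero_of_mem_rightHalf (add_ofReal_mem_rightHalf hw ht.1)
  have hdiff : w⁻¹ - (w + t)⁻¹ = t * (w⁻¹ * (w + t)⁻¹) := by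
    field_simp
    ring
  have hnorm : ‖(t : ℂ)‖ ≤ 1 := by
    rw [Complex.norm_real, Real.norm_of_nonneg ht.1]
    exact ht.2
  calc ‖w⁻¹ - (w + t)⁻¹‖ = ‖(t : ℂ)‖ * (‖w⁻¹‖ * ‖(w + (t : ℂ))⁻¹‖) := by
        rw [hdiff, norm_mul, norm_mul]
    _ ≤ 1 * (‖w⁻¹‖ * ‖w⁻¹‖) := by
        gcongr
        exact norm_inv_add_ofReal_le hw ht.1
    _ = ‖(w ^ 2)⁻¹‖ := by rw [one_mul, ← norm_mul, pow_two, mul_inv]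

theorem norm_inv_sub_log_sub_log_le {w : ℂ} (hw : w ∈ rightHalf) :
    ‖w⁻¹ - (Complex.log (w + 1) - Complex.log w)‖ ≤ ‖(w ^ 2)⁻¹‖ := by
  have hderiv : ∀ t ∈ Set.Icc (0 : ℝ) 1,
      HasDerivWithinAt (fun t : ℝ => t * w⁻¹ - Complex.log (w + t)) (w⁻¹ - (w + t)⁻¹)
        (Set.Icc 0 1) t := fun t ht => by
    have hlin : HasDerivAt (fun t : ℝ => (t : ℂ) * w⁻¹) w⁻¹ t := by
      simpa using (Complex.ofRealCLM.hasDerivAt (x := t)).mul_const w⁻¹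
    exact hlin.hasDerivWithinAt.sub (hasDerivWithinAt_log_add hw ht.1 _)
  have hmean := norm_image_sub_le_of_norm_deriv_le_segment_01' hderiv
    fun t ht => norm_inv_sub_inv_add_le hw (Set.Ico_subset_Icc_self ht)
  simp only [Complex.ofReal_one, Complex.ofReal_zero, one_mul, zero_mul, add_zero, zero_sub,
    sub_neg_eq_add] at hmean
  rwa [← sub_add]

theorem grows_inv : Grows (-1) fun w => w⁻¹ := by
  simpa using grows_inv_pow 1

theorem grows_inv_sub_log : Grows (-2)
    fun w => w⁻¹ - (Complex.log (w + 1) - Complex.log w) := fun ε hε =>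
  (Asymptotics.isBigO_principal.2 ⟨1, fun w hw => by
    simpa using norm_inv_sub_log_sub_log_le (halfPlane_subset_rightHalf hw)⟩).trans
      (grows_inv_pow 2 ε hε)

theorem grows_log_add_one_sub : Grows (-1) fun w => Complex.log (w + 1) - Complex.log w := by
  simpa using grows_inv.sub (grows_inv_sub_log.mono (by norm_num : (-2 : ℝ) ≤ -1))

section SumShift

/-- The sum `∑ s (w + n)` over all natural numbers `n`, the solution of `S w - S (w + 1) = s w` that
vanishes at infinity. -/
noncomputable def sumShift (s : ℂ → ℂ) (w : ℂ) : ℂ := ∑' n : ℕ, s (w + n)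

variable {s : ℂ → ℂ} {r : ℝ}

theorem summable_succ_rpow {c : ℝ} (hc : c < -1) : Summable fun n : ℕ => ((n : ℝ) + 1) ^ c := by
  exact_mod_cast (summable_nat_add_iff 1).2 (Real.summable_nat_rpow.2 hc)

theorem natCast_add_one_le {w : ℂ} (hw : w ∈ halfPlane) (n : ℕ) : (n : ℝ) + 1 ≤ 1 + ‖w + n‖ := by
  have hre := Complex.re_le_norm (w + n)
  rw [Complex.add_re, Complex.natCast_re] at hre
  linarith [mem_halfPlane.1 hw]

theorem exists_norm_shift_le (hs : Grows r s) {ε : ℝ} (hε : 0 < ε) (hle : r + 1 + ε ≤ 0) :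
    ∃ C, ∀ n : ℕ, ∀ w ∈ halfPlane,
      ‖s (w + n)‖ ≤ C * (1 + ‖w‖) ^ (r + 1 + ε) * ((n : ℝ) + 1) ^ (-1 - ε / 2) := by
  obtain ⟨C, hC, hs⟩ := (hs (ε / 2) (half_pos hε)).exists_nonneg
  refine ⟨C, fun n w hw => ?_⟩
  have hshift := Asymptotics.isBigOWith_principal.1 hs _ (add_natCast_mem_halfPlane hw n)
  have hnorm : ‖w‖ ≤ ‖w + n‖ := by
    simpa using norm_le_norm_add_ofReal (halfPlane_subset_rightHalf hw).le n.cast_nonneg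
  rw [Real.norm_of_nonneg (by positivity),
    show r + ε / 2 = (r + 1 + ε) + (-1 - ε / 2) by ring, Real.rpow_add (by positivity)] at hshift
  refine hshift.trans ?_
  rw [mul_assoc]
  gcongr C * (?_ * ?_)
  · exact Real.rpow_le_rpow_of_nonpos (by positivity) (by gcongr) hle
  · exact Real.rpow_le_rpow_of_nonpos (by positivity) (natCast_add_one_le hw n) (by linarith)

theorem exists_summable_norm_shift_le (hs : Grows r s) (hr : r < -1) :
    ∃ u : ℕ → ℝ, Summable u ∧ ∀ n : ℕ, ∀ w ∈ halfPlane, ‖s (w + n)‖ ≤ u n := by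
  obtain ⟨C, hC⟩ := exists_norm_shift_le hs (ε := -1 - r) (by linarith) (by linarith)
  refine ⟨_, (summable_succ_rpow (c := -1 - (-1 - r) / 2) (by linarith)).mul_left C,
    fun n w hw => (hC n w hw).trans_eq ?_⟩
  rw [show r + 1 + (-1 - r) = 0 by ring, Real.rpow_zero, mul_one]

theorem summable_shift (hs : Grows r s) (hr : r < -1) {w : ℂ} (hw : w ∈ rightHalf) :
    Summable fun n : ℕ => s (w + n) := by
  obtain ⟨u, hu, hle⟩ := exists_summable_norm_shift_le hs hr
  rw [← summable_nat_add_iff 1]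
  refine hu.of_norm_bounded fun n => ?_
  simpa [add_assoc, add_comm (1 : ℂ)] using hle n _ (add_one_mem_halfPlane hw)

theorem sumShift_eq (hs : Grows r s) (hr : r < -1) {w : ℂ} (hw : w ∈ rightHalf) :
    sumShift s w = s w + sumShift s (w + 1) := by
  rw [sumShift, (summable_shift hs hr hw).tsum_eq_zero_add, sumShift, Nat.cast_zero, add_zero]
  push_cast
  simp only [add_assoc, add_comm (1 : ℂ)]

theorem differentiableOn_sumShift (hs : Grows r s) (hr : r < -1)
    (hd : DifferentiableOn ℂ s rightHalf) : DifferentiableOn ℂ (sumShift s) rightHalf := by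
  obtain ⟨u, hu, hle⟩ := exists_summable_norm_shift_le hs hr
  have hshift : DifferentiableOn ℂ (fun w => sumShift s (w + 1)) rightHalf := by
    refine Complex.differentiableOn_tsum_of_summable_norm hu (fun n => ?_) isOpen_rightHalf
      fun n w hw => hle n _ (add_one_mem_halfPlane hw)
    refine hd.comp (by fun_prop) fun w hw => ?_
    exact_mod_cast add_ofReal_mem_rightHalf (add_one_mem_rightHalf hw) n.cast_nonneg
  exact (hd.add hshift).congr fun w hw => sumShift_eq hs hr hw

theorem grows_sumShift (hs : Grows r s) (hr : r < -1) : Grows (r + 1) (sumShift s) := by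
  refine hasOrderLE_of_forall_le (δ := -1 - r) (by linarith) fun ε hε hε_le => ?_
  obtain ⟨C, hC⟩ := exists_norm_shift_le hs hε (by linarith)
  have hsum := summable_succ_rpow (c := -1 - ε / 2) (by linarith)
  refine Asymptotics.isBigO_principal.2
    ⟨C * ∑' n : ℕ, ((n : ℝ) + 1) ^ (-1 - ε / 2), fun w hw => ?_⟩
  rw [Real.norm_of_nonneg (by positivity), mul_right_comm, ← tsum_mul_left]
  exact tsum_of_norm_bounded (hsum.mul_left _).hasSum fun n => hC n w hw

end SumShift

/-! ### Regularized multiple Hurwitz zeta functions -/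

section OnesExp

/-- The exponential of `a` times the letter `1` for the product `conv`: its value at `(1, …, 1)`,
of length `d`, is `a ^ d / d!`, and it vanishes at all other words. -/
def onesExp {K : Type*} [Field K] (a : K) (k : List ℕ+) : K :=
  if ∀ x ∈ k, x = 1 then a ^ k.length / (k.length.factorial : K) else 0

variable {K : Type*} [Field K]

theorem onesExp_nil (a : K) : onesExp a [] = 1 := by
  simp [onesExp]

theorem onesExp_cons_of_ne_one (a : K) {x : ℕ+} (hx : x ≠ 1) (k : List ℕ+) :
    onesExp a (x :: k) = 0 := by
  simp [onesExp, hx]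

theorem onesExp_of_forall (a : K) {k : List ℕ+} (hk : ∀ x ∈ k, x = 1) :
    onesExp a k = a ^ k.length / (k.length.factorial : K) :=
  if_pos hk

theorem onesExp_of_not_forall (a : K) {k : List ℕ+} (hk : ¬ ∀ x ∈ k, x = 1) : onesExp a k = 0 :=
  if_neg hk

theorem onesExp_reverse (a : K) (k : List ℕ+) : onesExp a k.reverse = onesExp a k := by
  simp [onesExp]

theorem conv_onesExp [CharZero K] (a b : K) :
    conv (onesExp a) (onesExp b) = onesExp (a + b) := by
  funext k
  by_cases hk : ∀ x ∈ k, x = 1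
  · rw [onesExp_of_forall _ hk, ← conv_pow_div_factorial, conv, conv]
    refine Finset.sum_congr rfl fun i _ => ?_
    rw [onesExp_of_forall _ fun x hx => hk x (List.mem_of_mem_take hx),
      onesExp_of_forall _ fun x hx => hk x (List.mem_of_mem_drop hx)]
  · rw [onesExp_of_not_forall _ hk]
    refine Finset.sum_eq_zero fun i _ => ?_
    rw [← List.take_append_drop i k, List.forall_mem_append, not_and_or] at hk
    rcases hk with hk | hk
    · rw [onesExp_of_not_forall _ hk, zero_mul]
    · rw [onesExp_of_not_forall _ hk, mul_zero]

theorem onesExp_eq (a : K) (k : List ℕ+) :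
    onesExp a k = onesExp 1 k * a ^ k.length := by
  by_cases hk : ∀ x ∈ k, x = 1
  · rw [onesExp_of_forall _ hk, onesExp_of_forall _ hk, one_pow, one_div_mul_eq_div]
  · rw [onesExp_of_not_forall _ hk, onesExp_of_not_forall _ hk, zero_mul]

end OnesExp

section OnesExpGrowth

variable {E 𝕜 : Type*} [SeminormedAddCommGroup E] [NormedField 𝕜] {l : Filter E} {a δ : E → 𝕜}

theorem hasOrderLE_onesExp (ha : HasOrderLE l 0 a) (k : List ℕ+) :
    HasOrderLE l 0 fun w => onesExp (a w) k := by
  simpa only [← onesExp_eq] using (ha.pow k.length).const_mul (onesExp 1 k)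

theorem hasOrderLE_add_pow_sub (ha : HasOrderLE l 0 a) (hδ : HasOrderLE l (-1) δ) (p : ℕ) :
    HasOrderLE l (-2) fun w => (a w + δ w) ^ (p + 1) - a w ^ (p + 1) - (p + 1) * a w ^ p * δ w := by
  induction p with
  | zero => exact hasOrderLE_zero.congr fun w => by push_cast; ring
  | succ p ih =>
    have hadd : HasOrderLE l 0 fun w => a w + δ w := ha.add (hδ.mono (by norm_num))
    have hfirst := hadd.mul ih
    have hsecond := ((ha.pow p).const_mul ((p : 𝕜) + 1)).mul (hδ.mul hδ)
    norm_num at hfirst hsecond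
    refine (hfirst.add hsecond).congr fun w => ?_
    push_cast
    ring

theorem hasOrderLE_onesExp_add_sub [CharZero 𝕜] (ha : HasOrderLE l 0 a) (hδ : HasOrderLE l (-1) δ)
    (k : List ℕ+) : HasOrderLE l (-2) fun w =>
      onesExp (a w + δ w) (1 :: k) - onesExp (a w) (1 :: k) - δ w * onesExp (a w) k := by
  by_cases hk : ∀ x ∈ k, x = 1
  · have hcons : ∀ x ∈ 1 :: k, x = 1 := List.forall_mem_cons.2 ⟨rfl, hk⟩
    refine ((hasOrderLE_add_pow_sub ha hδ k.length).const_mul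
      ((k.length + 1).factorial : 𝕜)⁻¹).congr fun w => ?_
    have hfact : (k.length.factorial : 𝕜) ≠ 0 := Nat.cast_ne_zero.2 k.length.factorial_ne_zero
    have hsucc : (k.length : 𝕜) + 1 ≠ 0 := Nat.cast_add_one_ne_zero k.length
    rw [onesExp_of_forall _ hcons, onesExp_of_forall _ hcons, onesExp_of_forall _ hk,
      List.length_cons, Nat.factorial_succ]
    push_cast
    field_simp
  · have hcons : ¬ ∀ x ∈ 1 :: k, x = 1 := fun h => hk (List.forall_mem_cons.1 h).2
    simpa only [onesExp_of_not_forall _ hcons, onesExp_of_not_forall _ hk, sub_zero, mul_zero]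
      using hasOrderLE_zero

end OnesExpGrowth

/-- `-(log w + γ)`, which the multiple Hurwitz zeta function of the word `1` approaches at
infinity. -/
noncomputable def negLogGamma (w : ℂ) : ℂ := -(Complex.log w + Real.eulerMascheroniConstant)

/-- The leading term at infinity of the regularized multiple Hurwitz zeta function of `k`. -/
noncomputable abbrev hurwitzLead (k : List ℕ+) (w : ℂ) : ℂ := onesExp (negLogGamma w) k

/-- The function whose translates are summed in the definition of `multiHurwitz`, where `F` is the
function of the word `k`. -/
noncomputable def hurwitzStep (x : ℕ+) (k : List ℕ+) (F : ℂ → ℂ) (v : ℂ) : ℂ :=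
  hurwitzLead (x :: k) (v + 1) - hurwitzLead (x :: k) v + (v ^ (x : ℕ))⁻¹ * F (v + 1)

/-- The regularized multiple Hurwitz zeta function
`∑ 1 / ((w + n₁) ^ k₁ ⋯ (w + n_d) ^ k_d)` over `0 ≤ n₁ < ⋯ < n_d`: the solution of the difference
equation `multiHurwitz_cons_eq` that is asymptotic to `hurwitzLead k w` at infinity. -/
noncomputable def multiHurwitz : List ℕ+ → ℂ → ℂ
  | [] => fun _ => 1
  | x :: k => fun w => hurwitzLead (x :: k) w + sumShift (hurwitzStep x k (multiHurwitz k)) w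

theorem multiHurwitz_cons (x : ℕ+) (k : List ℕ+) (w : ℂ) :
    multiHurwitz (x :: k) w =
      hurwitzLead (x :: k) w + sumShift (hurwitzStep x k (multiHurwitz k)) w := rfl

theorem grows_negLogGamma : Grows 0 negLogGamma := by
  refine ((grows_log.add (hasOrderLE_const _ (Real.eulerMascheroniConstant : ℂ))).const_mul
    (-1)).congr fun w => ?_
  rw [neg_one_mul, negLogGamma]

theorem grows_hurwitzLead (k : List ℕ+) : Grows 0 (hurwitzLead k) :=
  hasOrderLE_onesExp grows_negLogGamma k

theorem differentiableOn_hurwitzLead (k : List ℕ+) :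
    DifferentiableOn ℂ (hurwitzLead k) rightHalf := by
  have hlog : DifferentiableOn ℂ negLogGamma rightHalf := fun w hw =>
    ((Complex.differentiableAt_log (Or.inl hw)).add_const _).neg.differentiableWithinAt
  exact ((hlog.pow k.length).const_mul (onesExp 1 k)).congr fun w _ => onesExp_eq _ k

theorem two_le_of_ne_one {x : ℕ+} (hx : x ≠ 1) : 2 ≤ (x : ℕ) :=
  x.pos.nat_succ_le.lt_of_ne fun h => hx (PNat.coe_eq_one_iff.1 h.symm)

theorem grows_hurwitzLead_step (x : ℕ+) (k : List ℕ+) : Grows (-2) fun v =>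
    hurwitzLead (x :: k) (v + 1) - hurwitzLead (x :: k) v +
      (v ^ (x : ℕ))⁻¹ * hurwitzLead k (v + 1) := by
  by_cases hx : x = 1
  · subst hx
    have hlead := grows_inv_sub_log.mul (grows_hurwitzLead k).comp_add_one
    have hremainder := hasOrderLE_onesExp_add_sub grows_negLogGamma.comp_add_one
      grows_log_add_one_sub k
    rw [add_zero] at hlead
    refine (hlead.sub hremainder).congr fun v => ?_
    have hlog : negLogGamma (v + 1) + (Complex.log (v + 1) - Complex.log v) = negLogGamma v := by
      simp only [negLogGamma]
      ring
    simp only [hlog, PNat.one_coe, pow_one]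
    ring
  · have hx' : (2 : ℝ) ≤ (x : ℕ) := by exact_mod_cast two_le_of_ne_one hx
    have hinv := ((grows_inv_pow x).mono (neg_le_neg hx')).mul (grows_hurwitzLead k).comp_add_one
    simpa only [add_zero, hurwitzLead, onesExp_cons_of_ne_one _ hx, sub_zero, zero_add] using hinv

theorem grows_hurwitzStep {x : ℕ+} {k : List ℕ+}
    (hk : Grows (-1) fun w => multiHurwitz k w - hurwitzLead k w) :
    Grows (-2) (hurwitzStep x k (multiHurwitz k)) := by
  have hx : (1 : ℝ) ≤ (x : ℕ) := Nat.one_le_cast.2 x.pos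
  have htail := ((grows_inv_pow x).mono (neg_le_neg hx)).mul hk.comp_add_one
  norm_num at htail
  refine ((grows_hurwitzLead_step x k).add htail).congr fun v => ?_
  simp only [hurwitzStep]
  ring

theorem grows_multiHurwitz_sub_lead (k : List ℕ+) :
    Grows (-1) fun w => multiHurwitz k w - hurwitzLead k w := by
  induction k with
  | nil => simpa [multiHurwitz, onesExp_nil] using hasOrderLE_zero
  | cons x k ih =>
    have hsum := grows_sumShift (grows_hurwitzStep (x := x) ih) (by norm_num)
    norm_num at hsum
    simpa [multiHurwitz_cons] using hsum

theorem grows_multiHurwitz (k : List ℕ+) : Grows 0 (multiHurwitz k) := by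
  simpa using ((grows_multiHurwitz_sub_lead k).mono (by norm_num : (-1 : ℝ) ≤ 0)).add
    (grows_hurwitzLead k)

theorem differentiableOn_multiHurwitz (k : List ℕ+) :
    DifferentiableOn ℂ (multiHurwitz k) rightHalf := by
  induction k with
  | nil => exact differentiableOn_const 1
  | cons x k ih =>
    have hmaps : Set.MapsTo (fun w : ℂ => w + 1) rightHalf rightHalf :=
      fun w hw => add_one_mem_rightHalf hw
    have hinv : DifferentiableOn ℂ (fun v : ℂ => (v ^ (x : ℕ))⁻¹) rightHalf :=
      (differentiableOn_id.pow _).inv fun w hw => pow_ne_zero _ (ne_zero_of_mem_rightHalf hw)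
    have hlead := differentiableOn_hurwitzLead (x :: k)
    have hstep := ((hlead.comp (by fun_prop) hmaps).sub hlead).add
      (hinv.mul (ih.comp (by fun_prop) hmaps))
    exact hlead.add (differentiableOn_sumShift
      (grows_hurwitzStep (grows_multiHurwitz_sub_lead k)) (by norm_num) hstep)

theorem multiHurwitz_cons_eq (x : ℕ+) (k : List ℕ+) {w : ℂ} (hw : w ∈ rightHalf) :
    multiHurwitz (x :: k) w =
      multiHurwitz (x :: k) (w + 1) + (w ^ (x : ℕ))⁻¹ * multiHurwitz k (w + 1) := by
  rw [multiHurwitz_cons,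
    sumShift_eq (grows_hurwitzStep (grows_multiHurwitz_sub_lead k)) (by norm_num) hw,
    multiHurwitz_cons, hurwitzStep]
  ring

/-- The function on words with value `1` at the empty word, `u ^ (-x)` at the one-letter word `x`
and zero at longer words: the contribution of the single point `u` to a multiple sum. -/
noncomputable def point (u : ℂ) : List ℕ+ → ℂ := letterFun fun x => (u ^ (x : ℕ))⁻¹

theorem multiHurwitz_eq_conv {w : ℂ} (hw : w ∈ rightHalf) :
    (fun k => multiHurwitz k w) = conv (point w) fun k => multiHurwitz k (w + 1) := by
  funext k
  cases k with
  | nil => simp [point, letterFun, conv_nil, multiHurwitz]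
  | cons x k => rw [point, conv_letterFun_cons, multiHurwitz_cons_eq x k hw]

/-! ### Taylor coefficients -/

section TaylorCoeff

/-- The `n`-th coefficient of the Taylor expansion of `g` at `w`. -/
noncomputable def taylorCoeff {𝕜 : Type*} [NontriviallyNormedField 𝕜] (n : ℕ) (g : 𝕜 → 𝕜) (w : 𝕜) :
    𝕜 :=
  iteratedDeriv n g w / (n.factorial : 𝕜)

variable {𝕜 : Type*} [NontriviallyNormedField 𝕜]

theorem taylorCoeff_zero (g : 𝕜 → 𝕜) (w : 𝕜) : taylorCoeff 0 g w = g w := by simp [taylorCoeff]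

theorem taylorCoeff_const {n : ℕ} (hn : n ≠ 0) (c w : 𝕜) : taylorCoeff n (fun _ => c) w = 0 := by
  simp [taylorCoeff, iteratedDeriv_const, hn]

theorem taylorCoeff_congr {f g : 𝕜 → 𝕜} {w : 𝕜} (h : f =ᶠ[𝓝 w] g) (n : ℕ) :
    taylorCoeff n f w = taylorCoeff n g w := by
  rw [taylorCoeff, h.iteratedDeriv_eq, taylorCoeff]

theorem taylorCoeff_add {f g : 𝕜 → 𝕜} {w : 𝕜} {n : ℕ} (hf : ContDiffAt 𝕜 n f w)
    (hg : ContDiffAt 𝕜 n g w) :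
    taylorCoeff n (fun v => f v + g v) w = taylorCoeff n f w + taylorCoeff n g w := by
  rw [taylorCoeff, iteratedDeriv_fun_add hf hg, add_div, taylorCoeff, taylorCoeff]

theorem taylorCoeff_const_mul (c : 𝕜) (g : 𝕜 → 𝕜) (n : ℕ) (w : 𝕜) :
    taylorCoeff n (fun v => c * g v) w = c * taylorCoeff n g w := by
  rw [taylorCoeff, iteratedDeriv_const_mul_field, mul_div_assoc, taylorCoeff]

theorem taylorCoeff_comp_add_const (n : ℕ) (g : 𝕜 → 𝕜) (c w : 𝕜) :
    taylorCoeff n (fun v => g (v + c)) w = taylorCoeff n g (w + c) := by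
  rw [taylorCoeff, iteratedDeriv_comp_add_const, taylorCoeff]

variable [CharZero 𝕜]

theorem taylorCoeff_mul {f g : 𝕜 → 𝕜} {w : 𝕜} {n : ℕ} (hf : ContDiffAt 𝕜 n f w)
    (hg : ContDiffAt 𝕜 n g w) :
    taylorCoeff n (fun v => f v * g v) w =
      ∑ p ∈ antidiagonal n, taylorCoeff p.1 f w * taylorCoeff p.2 g w := by
  rw [taylorCoeff, iteratedDeriv_fun_mul hf hg, Finset.sum_div,
    Finset.Nat.sum_antidiagonal_eq_sum_range_succ fun a b => taylorCoeff a f w * taylorCoeff b g w]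
  refine Finset.sum_congr rfl fun i hi => ?_
  have hi' : i ≤ n := Finset.mem_range_succ_iff.1 hi
  have hfact (m : ℕ) : (m.factorial : 𝕜) ≠ 0 := Nat.cast_ne_zero.2 m.factorial_ne_zero
  rw [Nat.cast_choose 𝕜 hi', taylorCoeff, taylorCoeff]
  field_simp [hfact]

theorem taylorCoeff_inv_pow (n m : ℕ) (w : 𝕜) :
    taylorCoeff n (fun v => (v ^ (m + 1))⁻¹) w =
      (-1) ^ n * ((m + n).choose n : 𝕜) * (w ^ (m + n + 1))⁻¹ := by
  have hzpow : (fun v : 𝕜 => (v ^ (m + 1))⁻¹) = fun v => v ^ (-(m + 1) : ℤ) := by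
    funext v
    rw [zpow_neg]
    norm_cast
  have hprod : ∏ i ∈ Finset.range n, (((-(m + 1) : ℤ) : 𝕜) - i) =
      (-1) ^ n * (n.factorial * (m + n).choose n) := by
    rw [← Nat.cast_mul, ← Nat.ascFactorial_eq_factorial_mul_choose, Nat.ascFactorial_eq_prod_range,
      Nat.cast_prod]
    nth_rw 2 [← Finset.card_range n]
    rw [← Finset.prod_const, ← Finset.prod_mul_distrib]
    refine Finset.prod_congr rfl fun i _ => ?_
    push_cast
    ring
  have hexp : w ^ (-(m + 1) - n : ℤ) = (w ^ (m + n + 1))⁻¹ := by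
    rw [show (-(m + 1) - n : ℤ) = -((m + n + 1 : ℕ) : ℤ) by push_cast; ring, zpow_neg,
      zpow_natCast]
  have hfact : (n.factorial : 𝕜) ≠ 0 := Nat.cast_ne_zero.2 n.factorial_ne_zero
  rw [taylorCoeff, iteratedDeriv_eq_iterate, hzpow, iter_deriv_zpow, hprod, hexp]
  field_simp

end TaylorCoeff

section TaylorSum

/-- The sum of `(-1) ^ a ∏ⱼ (kⱼ - 1 + aⱼ choose aⱼ) F (k₁ + a₁, …, k_d + a_d)` over
`a₁ + ⋯ + a_d = a`, by recursion on the word: the Taylor coefficient of order `a` of a function of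
`w` on words that is built from the powers `(w + n) ^ (-x)`. Here `(x - 1 + b).succPNat` is
`x + b`. -/
def taylorSum {R : Type*} [CommRing R] : (List ℕ+ → R) → ℕ → List ℕ+ → R
  | F, a, [] => if a = 0 then F [] else 0
  | F, a, x :: k => ∑ p ∈ antidiagonal a,
      (-1) ^ p.1 * (((x : ℕ) - 1 + p.1).choose p.1 : R) *
        taylorSum (fun l => F (Nat.succPNat ((x : ℕ) - 1 + p.1) :: l)) p.2 k

variable {R : Type*} [CommRing R]

theorem taylorSum_zero (F : List ℕ+ → R) (k : List ℕ+) : taylorSum F 0 k = F k := by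
  induction k generalizing F with
  | nil => simp [taylorSum]
  | cons x k ih =>
    have hx : Nat.succPNat ((x : ℕ) - 1) = x := PNat.succPNat_natPred x
    simp [taylorSum, ih, hx]

theorem taylorSum_add (F G : List ℕ+ → R) (a : ℕ) (k : List ℕ+) :
    taylorSum (fun l => F l + G l) a k = taylorSum F a k + taylorSum G a k := by
  induction k generalizing F G a with
  | nil => simp only [taylorSum]; split_ifs <;> simp
  | cons x k ih => simp only [taylorSum, ih, mul_add, Finset.sum_add_distrib]

theorem taylorSum_const_mul (c : R) (F : List ℕ+ → R) (a : ℕ) (k : List ℕ+) :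
    taylorSum (fun l => c * F l) a k = c * taylorSum F a k := by
  induction k generalizing F a with
  | nil => simp [taylorSum]
  | cons x k ih =>
    simp only [taylorSum, ih, Finset.mul_sum]
    exact Finset.sum_congr rfl fun p _ => by ring

theorem sum_antidiagonalTuple_succ {M : Type*} [AddCommMonoid M] (n a : ℕ)
    (f : (Fin (n + 1) → ℕ) → M) :
    ∑ α ∈ Finset.Nat.antidiagonalTuple (n + 1) a, f α =
      ∑ p ∈ antidiagonal a, ∑ β ∈ Finset.Nat.antidiagonalTuple n p.2,
        f (Fin.cons p.1 β) := by
  rw [Finset.sum_sigma']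
  refine Finset.sum_bij' (fun α _ => ⟨(α 0, ∑ i, Fin.tail α i), Fin.tail α⟩)
    (fun q _ => Fin.cons q.1.1 q.2) ?_ ?_ ?_ ?_ ?_
  · intro α hα
    rw [Finset.Nat.mem_antidiagonalTuple, Fin.sum_univ_succ] at hα
    simp only [Finset.mem_sigma, mem_antidiagonal, Finset.Nat.mem_antidiagonalTuple]
    exact ⟨hα, trivial⟩
  · rintro ⟨⟨b, c⟩, β⟩ hq
    simp only [Finset.mem_sigma, mem_antidiagonal, Finset.Nat.mem_antidiagonalTuple] at hq
    rw [Finset.Nat.mem_antidiagonalTuple, Fin.sum_univ_succ]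
    simp [hq.1, hq.2]
  · exact fun α _ => Fin.cons_self_tail α
  · rintro ⟨⟨b, c⟩, β⟩ hq
    simp only [Finset.mem_sigma, mem_antidiagonal, Finset.Nat.mem_antidiagonalTuple] at hq
    simp [hq.2]
  · simp only [Fin.cons_self_tail, implies_true]

theorem taylorSum_eq (F : List ℕ+ → R) (a : ℕ) (k : List ℕ+) :
    taylorSum F a k = (-1) ^ a * ∑ α ∈ Finset.Nat.antidiagonalTuple k.length a,
      F (List.ofFn fun j => Nat.succPNat ((k.get j : ℕ) - 1 + α j)) *
        ∏ j, ((((k.get j : ℕ) - 1 + α j).choose (α j) : ℕ) : R) := by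
  induction k generalizing F a with
  | nil => cases a <;> simp [taylorSum]
  | cons x k ih =>
    simp only [List.length_cons]
    rw [sum_antidiagonalTuple_succ, Finset.mul_sum, taylorSum]
    refine Finset.sum_congr rfl fun p hp => ?_
    rw [ih, ← mem_antidiagonal.1 hp, pow_add, Finset.mul_sum, Finset.mul_sum, Finset.mul_sum]
    refine Finset.sum_congr rfl fun β _ => ?_
    rw [Fin.prod_univ_succ, List.ofFn_succ]
    simp only [Fin.cons_zero, Fin.cons_succ, List.get_eq_getElem, List.getElem_cons_succ,
      Fin.val_succ, Fin.val_zero, List.getElem_cons_zero]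
    ring

theorem tendsto_taylorSum_zero [TopologicalSpace R] [IsTopologicalRing R] {ι : Type*}
    {l : Filter ι} {F : ι → List ℕ+ → R}
    (hF : ∀ k, (¬ ∀ x ∈ k, x = 1) → Tendsto (fun i => F i k) l (𝓝 0)) {a : ℕ} (ha : a ≠ 0)
    (k : List ℕ+) : Tendsto (fun i => taylorSum (F i) a k) l (𝓝 0) := by
  simp only [taylorSum_eq]
  rw [← mul_zero ((-1 : R) ^ a)]
  refine Tendsto.const_mul _ ?_
  rw [← Finset.sum_const_zero (s := Finset.Nat.antidiagonalTuple k.length a)]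
  refine tendsto_finsetSum _ fun α hα => ?_
  have hne : ∃ j, α j ≠ 0 := by
    by_contra! hzero
    exact ha (by simpa [hzero] using (Finset.Nat.mem_antidiagonalTuple.1 hα).symm)
  obtain ⟨j, hj⟩ := hne
  rw [← zero_mul (∏ j, ((((k.get j : ℕ) - 1 + α j).choose (α j) : ℕ) : R))]
  refine (hF _ fun hones => hj ?_).mul_const _
  have hletter := congrArg PNat.val (hones _ (List.mem_ofFn.2 ⟨j, rfl⟩))
  simp only [Nat.succPNat, PNat.mk_coe, PNat.val_ofNat] at hletter
  omega

end TaylorSum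

theorem zetaTaylor_eq (a : ℕ) (k : List ℕ+) : zetaTaylor a k = taylorSum zetaReg a k :=
  (taylorSum_eq zetaReg a k).symm

section Decay

theorem norm_taylorCoeff_le {g : ℂ → ℂ} {w : ℂ} {ρ C : ℝ} (n : ℕ) (hρ : 0 < ρ)
    (hg : DiffContOnCl ℂ g (Metric.ball w ρ)) (hC : ∀ v ∈ Metric.sphere w ρ, ‖g v‖ ≤ C) :
    ‖taylorCoeff n g w‖ ≤ C / ρ ^ n := by
  rw [taylorCoeff, norm_div, Complex.norm_natCast,
    div_le_iff₀ (Nat.cast_pos.2 n.factorial_pos), mul_comm, ← mul_div_assoc]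
  exact Complex.norm_iteratedDeriv_le_of_forall_mem_sphere_norm_le n hρ hg hC

theorem tendsto_add_natCast {w : ℂ} (hw : w ∈ rightHalf) :
    Tendsto (fun n : ℕ => w + n) atTop (𝓟 halfPlane ⊓ Bornology.cobounded ℂ) := by
  refine tendsto_inf.2 ⟨tendsto_principal.2 ?_, ?_⟩
  · filter_upwards [eventually_ge_atTop 1] with n hn
    have hn' : (1 : ℝ) ≤ n := Nat.one_le_cast.2 hn
    rw [mem_halfPlane, Complex.add_re, Complex.natCast_re]
    linarith [mem_rightHalf.1 hw]
  · refine tendsto_norm_atTop_iff_cobounded.1 (tendsto_atTop_mono (fun n => ?_)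
      (tendsto_atTop_add_const_right _ (-‖w‖) tendsto_natCast_atTop_atTop))
    have htriangle := norm_sub_norm_le (n : ℂ) (-w)
    rw [norm_neg, sub_neg_eq_add, Complex.norm_natCast] at htriangle
    rwa [← sub_eq_add_neg, add_comm w]

theorem closedBall_subset_halfPlane {w : ℂ} (hw : w ∈ rightHalf) {n : ℕ} (hn : 1 ≤ n) :
    Metric.closedBall (w + n) ((n : ℝ) / 2) ⊆ halfPlane := fun v hv => by
  have hn' : (1 : ℝ) ≤ n := Nat.one_le_cast.2 hn
  have hre := (abs_le.1 ((Complex.abs_re_le_norm _).trans (mem_closedBall_iff_norm.1 hv))).1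
  simp only [Complex.sub_re, Complex.add_re, Complex.natCast_re] at hre
  rw [mem_halfPlane]
  linarith [mem_rightHalf.1 hw]

theorem tendsto_taylorCoeff_of_grows {g : ℂ → ℂ} (hg : Grows 0 g)
    (hd : DifferentiableOn ℂ g rightHalf) {a : ℕ} (ha : a ≠ 0) {w : ℂ} (hw : w ∈ rightHalf) :
    Tendsto (fun n : ℕ => taylorCoeff a g (w + n)) atTop (𝓝 0) := by
  obtain ⟨C, hC, hgC⟩ := (hg (1 / 2) (by norm_num)).exists_pos
  rw [Asymptotics.isBigOWith_principal, zero_add] at hgC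
  have hscale : Tendsto (fun n : ℕ => 3 * (n : ℝ)) atTop atTop :=
    tendsto_natCast_atTop_atTop.const_mul_atTop (by norm_num)
  have hlim := ((tendsto_rpow_neg_atTop (one_half_pos (α := ℝ))).comp hscale).const_mul (6 * C)
  rw [mul_zero] at hlim
  refine squeeze_zero_norm' ?_ hlim
  filter_upwards [eventually_ge_atTop 2, eventually_ge_atTop ⌈1 + ‖w‖⌉₊] with n hn hnw
  have hn' : (2 : ℝ) ≤ n := by exact_mod_cast hn
  have hball := closedBall_subset_halfPlane hw (one_le_two.trans hn)
  have hsphere : ∀ v ∈ Metric.sphere (w + n) ((n : ℝ) / 2), ‖g v‖ ≤ C * (3 * n) ^ (1 / 2 : ℝ) := by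
    intro v hv
    have hv' : ‖v‖ ≤ ‖w‖ + n + n / 2 := by
      have hvw := norm_le_norm_add_norm_sub' v (w + n)
      rw [mem_sphere_iff_norm.1 hv] at hvw
      have hwn := norm_add_le w n
      rw [Complex.norm_natCast] at hwn
      linarith
    refine (hgC v (hball (Metric.sphere_subset_closedBall hv))).trans ?_
    rw [Real.norm_of_nonneg (by positivity)]
    gcongr
    linarith [Nat.ceil_le.1 hnw]
  have hdiff : DiffContOnCl ℂ g (Metric.ball (w + n) ((n : ℝ) / 2)) :=
    (hd.mono (Metric.closure_ball_subset_closedBall.trans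
      (hball.trans halfPlane_subset_rightHalf))).diffContOnCl
  calc ‖taylorCoeff a g (w + n)‖ ≤ C * (3 * n) ^ (1 / 2 : ℝ) / (n / 2) ^ a :=
        norm_taylorCoeff_le a (by linarith) hdiff hsphere
    _ ≤ C * (3 * n) ^ (1 / 2 : ℝ) / (n / 2) := by
        gcongr
        exact le_self_pow₀ (by linarith) ha
    _ = 6 * C * (3 * n) ^ (-(1 / 2) : ℝ) := by
        rw [show (-(1 / 2) : ℝ) = 1 / 2 - 1 by norm_num, Real.rpow_sub_one (by positivity)]
        field_simp
        norm_num

end Decay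

section MultiHurwitzTaylor

theorem contDiffAt_multiHurwitz (k : List ℕ+) {w : ℂ} (hw : w ∈ rightHalf) (n : WithTop ℕ∞) :
    ContDiffAt ℂ n (multiHurwitz k) w :=
  ((differentiableOn_multiHurwitz k).analyticAt (isOpen_rightHalf.mem_nhds hw)).contDiffAt

theorem tendsto_multiHurwitz_add_natCast {k : List ℕ+} (hk : ¬ ∀ x ∈ k, x = 1) {w : ℂ}
    (hw : w ∈ rightHalf) : Tendsto (fun n : ℕ => multiHurwitz k (w + n)) atTop (𝓝 0) := by
  have hgrows := grows_multiHurwitz_sub_lead k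
  simp only [hurwitzLead, onesExp_of_not_forall _ hk, sub_zero] at hgrows
  exact (hgrows.tendsto_zero (by norm_num)).comp (tendsto_add_natCast hw)

theorem taylorCoeff_multiHurwitz_cons (a : ℕ) (x : ℕ+) (k : List ℕ+) {w : ℂ}
    (hw : w ∈ rightHalf) :
    taylorCoeff a (multiHurwitz (x :: k)) w = taylorCoeff a (multiHurwitz (x :: k)) (w + 1) +
      ∑ p ∈ antidiagonal a, (-1) ^ p.1 * (((x : ℕ) - 1 + p.1).choose p.1 : ℂ) *
        (w ^ (Nat.succPNat ((x : ℕ) - 1 + p.1) : ℕ))⁻¹ *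
          taylorCoeff p.2 (multiHurwitz k) (w + 1) := by
  have hw1 := add_one_mem_rightHalf hw
  have hshift (l : List ℕ+) : ContDiffAt ℂ a (fun v => multiHurwitz l (v + 1)) w :=
    (contDiffAt_multiHurwitz l hw1 a).comp w (by fun_prop)
  have hx : (x : ℕ) = (x : ℕ) - 1 + 1 := (Nat.sub_add_cancel x.pos).symm
  have hinv : ContDiffAt ℂ a (fun v : ℂ => (v ^ (x : ℕ))⁻¹) w :=
    (contDiffAt_id.pow _).inv (pow_ne_zero _ (ne_zero_of_mem_rightHalf hw))
  have hgerm : multiHurwitz (x :: k) =ᶠ[𝓝 w] fun v =>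
      multiHurwitz (x :: k) (v + 1) + (v ^ (x : ℕ))⁻¹ * multiHurwitz k (v + 1) := by
    filter_upwards [isOpen_rightHalf.mem_nhds hw] with v hv
    exact multiHurwitz_cons_eq x k hv
  rw [taylorCoeff_congr hgerm, taylorCoeff_add (hshift _) (hinv.mul (hshift _)),
    taylorCoeff_comp_add_const, taylorCoeff_mul hinv (hshift _), hx]
  simp only [taylorCoeff_inv_pow, taylorCoeff_comp_add_const, Nat.succPNat_coe, Nat.succ_eq_add_one,
    Nat.add_sub_cancel]

theorem taylorSum_multiHurwitz_cons (a : ℕ) (x : ℕ+) (k : List ℕ+) {w : ℂ} (hw : w ∈ rightHalf) :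
    taylorSum (fun l => multiHurwitz l w) a (x :: k) =
      taylorSum (fun l => multiHurwitz l (w + 1)) a (x :: k) +
        ∑ p ∈ antidiagonal a, (-1) ^ p.1 * (((x : ℕ) - 1 + p.1).choose p.1 : ℂ) *
          (w ^ (Nat.succPNat ((x : ℕ) - 1 + p.1) : ℕ))⁻¹ *
            taylorSum (fun l => multiHurwitz l (w + 1)) p.2 k := by
  simp only [taylorSum, multiHurwitz_cons_eq _ _ hw, taylorSum_add, taylorSum_const_mul, mul_add,
    Finset.sum_add_distrib, mul_assoc]

theorem taylorCoeff_multiHurwitz (a : ℕ) (k : List ℕ+) {w : ℂ} (hw : w ∈ rightHalf) :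
    taylorCoeff a (multiHurwitz k) w = taylorSum (fun l => multiHurwitz l w) a k := by
  induction k generalizing a w with
  | nil =>
    rcases eq_or_ne a 0 with rfl | ha
    · rw [taylorCoeff_zero, taylorSum_zero]
    · rw [multiHurwitz, taylorCoeff_const ha, taylorSum, if_neg ha]
  | cons x k ih =>
    rcases eq_or_ne a 0 with rfl | ha
    · rw [taylorCoeff_zero, taylorSum_zero]
    have hperiodic {v : ℂ} (hv : v ∈ rightHalf) :
        taylorCoeff a (multiHurwitz (x :: k)) v - taylorSum (fun l => multiHurwitz l v) a (x :: k) =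
          taylorCoeff a (multiHurwitz (x :: k)) (v + 1) -
            taylorSum (fun l => multiHurwitz l (v + 1)) a (x :: k) := by
      rw [taylorCoeff_multiHurwitz_cons a x k hv, taylorSum_multiHurwitz_cons a x k hv]
      simp only [ih _ (add_one_mem_rightHalf hv), add_sub_add_right_eq_sub]
    have hconst (n : ℕ) : taylorCoeff a (multiHurwitz (x :: k)) (w + n) -
        taylorSum (fun l => multiHurwitz l (w + n)) a (x :: k) =
          taylorCoeff a (multiHurwitz (x :: k)) w -
            taylorSum (fun l => multiHurwitz l w) a (x :: k) := by
      induction n with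
      | zero => simp
      | succ n ihn =>
        rw [← ihn, hperiodic (v := w + n)
          (by exact_mod_cast add_ofReal_mem_rightHalf hw n.cast_nonneg), Nat.cast_succ, add_assoc]
    have hlim := (tendsto_taylorCoeff_of_grows (grows_multiHurwitz (x :: k))
      (differentiableOn_multiHurwitz (x :: k)) ha hw).sub (tendsto_taylorSum_zero
        (fun l hl => tendsto_multiHurwitz_add_natCast hl hw) ha (x :: k))
    simp only [hconst, sub_zero] at hlim
    exact sub_eq_zero.1 (tendsto_nhds_unique tendsto_const_nhds hlim)

end MultiHurwitzTaylor

/-! ### Expansions in powers of `log N + γ` -/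

/-- `f` agrees with the polynomial `P` in `log N + γ`, up to a negligible error. -/
def ExpandsTo (f : ℕ → ℝ) (P : Polynomial ℝ) : Prop :=
  Negligible fun N => f N - P.eval (logGamma N)

section ExpandsTo

variable {f g : ℕ → ℝ} {P Q : Polynomial ℝ}

theorem Negligible.expandsTo_zero (hf : Negligible f) : ExpandsTo f 0 := by
  simpa [ExpandsTo] using hf

theorem expandsTo_const (c : ℝ) : ExpandsTo (fun _ => c) (Polynomial.C c) := fun j => by simp

namespace ExpandsTo

theorem add (hf : ExpandsTo f P) (hg : ExpandsTo g Q) :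
    ExpandsTo (fun N => f N + g N) (P + Q) := by
  unfold ExpandsTo
  convert Negligible.add hf hg using 2 with N
  rw [Polynomial.eval_add]
  ring

theorem mul (hf : ExpandsTo f P) (hg : ExpandsTo g Q) :
    ExpandsTo (fun N => f N * g N) (P * Q) := by
  unfold ExpandsTo
  convert ((Negligible.mul_eval hf Q).add (Negligible.mul_eval hg P)).add (Negligible.mul hf hg)
    using 2 with N
  rw [Polynomial.eval_mul]
  ring

theorem pow (hf : ExpandsTo f P) (n : ℕ) : ExpandsTo (fun N => f N ^ n) (P ^ n) := by
  induction n with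
  | zero => simpa using expandsTo_const 1
  | succ n ih => simpa [pow_succ] using ih.mul hf

theorem finset_sum {ι : Type*} (s : Finset ι) {F : ι → ℕ → ℝ} {p : ι → Polynomial ℝ}
    (h : ∀ i ∈ s, ExpandsTo (F i) (p i)) :
    ExpandsTo (fun N => ∑ i ∈ s, F i N) (∑ i ∈ s, p i) := by
  classical
  induction s using Finset.induction_on with
  | empty => simpa using expandsTo_const 0
  | insert a s ha ih =>
    simp only [Finset.sum_insert ha]
    exact (h a (Finset.mem_insert_self a s)).add
      (ih fun i hi => h i (Finset.mem_insert_of_mem hi))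

theorem list_map_sum {ι : Type*} (l : List ι) {F : ι → ℕ → ℝ} {p : ι → Polynomial ℝ}
    (h : ∀ i, ExpandsTo (F i) (p i)) :
    ExpandsTo (fun N => (l.map fun i => F i N).sum) (l.map p).sum := by
  induction l with
  | nil => simpa using expandsTo_const 0
  | cons i l ih => simpa only [List.map_cons, List.sum_cons] using (h i).add ih

theorem conv {α : Type*} {F G : ℕ → List α → ℝ} {p q : List α → Polynomial ℝ}
    (hF : ∀ k, ExpandsTo (fun N => F N k) (p k)) (hG : ∀ k, ExpandsTo (fun N => G N k) (q k))
    (k : List α) : ExpandsTo (fun N => conv (F N) (G N) k) (conv p q k) :=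
  finset_sum _ fun i _ => (hF (k.take i)).mul (hG (k.drop i))

theorem eq_eval_zero {c : ℝ} (h : ExpandsTo (fun _ => c) P) : c = P.eval 0 := by
  have hsub : Tendsto (fun N => (P - Polynomial.C c).eval (logGamma N)) atTop (𝓝 0) := by
    simpa using (h 0).neg
  rw [sub_eq_zero.1 (eq_zero_of_tendsto hsub), Polynomial.eval_C]

end ExpandsTo

end ExpandsTo

theorem expandsTo_truncSum (k : List ℕ+) : ExpandsTo (fun N => truncSum N 0 k) (regPoly k) := by
  obtain ⟨P, hP⟩ := hasExpansion_truncSum k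
  have hreg : IsRegPoly k P := by simpa [IsRegPoly, logGamma] using hP 0
  rwa [hreg.eq_regPoly] at hP

theorem eval_zero_conv {α : Type*} (p q : List α → Polynomial ℝ) (k : List α) :
    (conv p q k).eval 0 = conv (fun l => (p l).eval 0) (fun l => (q l).eval 0) k := by
  simp only [conv, Polynomial.eval_finsetSum, Polynomial.eval_mul]

/-! ### Multiple Hurwitz zeta functions at `1` -/

section HurwitzOne

theorem add_one_mem_halfPlane_natCast (N : ℕ) : (N : ℂ) + 1 ∈ halfPlane := by
  rw [add_comm]
  exact add_natCast_mem_halfPlane (mem_halfPlane.2 (by norm_num)) N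

theorem truncSum_add_one_eq_conv (N : ℕ) : (fun k => (truncSum (N + 1) 0 k : ℂ)) =
    conv (fun k => (truncSum N 0 k : ℂ)) (point (N + 1)) := by
  funext k
  induction k using List.reverseRecOn with
  | nil => simp [truncSum, conv_nil, point, letterFun]
  | append_singleton k x _ =>
    rw [point, conv_letterFun_append, truncSum_succ N x k 0 (Nat.zero_le N)]
    push_cast
    ring

theorem conv_truncSum_multiHurwitz (N : ℕ) :
    conv (fun k => (truncSum N 0 k : ℂ)) (fun k => multiHurwitz k (N + 1)) =
      fun k => multiHurwitz k 1 := by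
  induction N with
  | zero =>
    have hunit : (fun k => (truncSum 0 0 k : ℂ)) = convUnit := by
      funext k
      cases k <;> simp [truncSum, convUnit]
    simp [hunit, conv_unit_left]
  | succ N ih =>
    rw [truncSum_add_one_eq_conv, conv_assoc, ← ih, multiHurwitz_eq_conv
      (halfPlane_subset_rightHalf (add_one_mem_halfPlane_natCast N)), Nat.cast_succ]

theorem negligible_of_grows {g : ℂ → ℂ} (hg : Grows (-1) g) (φ : ℂ →L[ℝ] ℝ) :
    Negligible fun N : ℕ => φ (g (N + 1)) := by
  obtain ⟨C, hC, hgC⟩ := (hg (1 / 2) (by norm_num)).exists_pos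
  rw [Asymptotics.isBigOWith_principal] at hgC
  refine negligible_of_le (‖φ‖ * C) ?_
  filter_upwards [eventually_ge_atTop 1] with N hN
  have hN' : (0 : ℝ) < N := Nat.cast_pos.2 hN
  have hnorm : (N : ℝ) ≤ 1 + ‖(N : ℂ) + 1‖ := by
    rw [← Nat.cast_succ, Complex.norm_natCast]
    push_cast
    linarith
  calc |φ (g (N + 1))| ≤ ‖φ‖ * ‖g (N + 1)‖ := φ.le_opNorm _
    _ ≤ ‖φ‖ * (C * ‖(1 + ‖(N : ℂ) + 1‖) ^ (-1 + 1 / 2 : ℝ)‖) := by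
      gcongr
      exact hgC _ (add_one_mem_halfPlane_natCast N)
    _ ≤ ‖φ‖ * C * (N : ℝ) ^ (-(1 / 2) : ℝ) := by
      rw [Real.norm_of_nonneg (by positivity), mul_assoc,
        show (-1 + 1 / 2 : ℝ) = -(1 / 2) by norm_num]
      gcongr ‖φ‖ * (C * ?_)
      exact Real.rpow_le_rpow_of_nonpos hN' hnorm (by norm_num)

theorem expandsTo_neg_log_add_one :
    ExpandsTo (fun N => -(Real.log (N + 1) + Real.eulerMascheroniConstant)) (-Polynomial.X) := by
  refine negligible_of_le 1 ?_
  filter_upwards [eventually_ge_atTop 1] with N hN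
  have hN' : (1 : ℝ) ≤ N := Nat.one_le_cast.2 hN
  have hpos : (0 : ℝ) < N := by linarith
  have hmono : Real.log (N : ℝ) ≤ Real.log ((N : ℝ) + 1) :=
    Real.log_le_log hpos (by linarith)
  have hstep : Real.log ((N : ℝ) + 1) - Real.log N ≤ (N : ℝ) ^ (-(1 / 2) : ℝ) :=
    calc Real.log ((N : ℝ) + 1) - Real.log N = Real.log (((N : ℝ) + 1) / N) :=
          (Real.log_div (by positivity) hpos.ne').symm
      _ ≤ ((N : ℝ) + 1) / N - 1 := Real.log_le_sub_one_of_pos (by positivity)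
      _ = (N : ℝ) ^ (-1 : ℝ) := by
        rw [Real.rpow_neg_one]
        field_simp
        ring
      _ ≤ (N : ℝ) ^ (-(1 / 2) : ℝ) := Real.rpow_le_rpow_of_exponent_le hN' (by norm_num)
  rw [Polynomial.eval_neg, Polynomial.eval_X, logGamma, abs_le]
  constructor <;> linarith

/-- The polynomial in `log N + γ` that describes `hurwitzLead k (N + 1)`. -/
noncomputable def leadPoly (k : List ℕ+) : Polynomial ℝ :=
  Polynomial.C (onesExp 1 k) * (-Polynomial.X) ^ k.length

theorem eval_zero_leadPoly (k : List ℕ+) : (leadPoly k).eval 0 = convUnit k := by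
  cases k <;> simp [leadPoly, onesExp_nil, convUnit]

theorem hurwitzLead_natCast_add_one (k : List ℕ+) (N : ℕ) : hurwitzLead k (N + 1) =
    ((onesExp 1 k * (-(Real.log (N + 1) + Real.eulerMascheroniConstant)) ^ k.length : ℝ) : ℂ) := by
  have hlog : Complex.log ((N : ℂ) + 1) = (Real.log ((N : ℝ) + 1) : ℂ) := by
    rw [Complex.ofReal_log (by positivity)]
    push_cast
    rfl
  rw [hurwitzLead, onesExp_eq, negLogGamma, hlog]
  by_cases hk : ∀ x ∈ k, x = 1
  · simp [onesExp_of_forall _ hk]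
  · simp [onesExp_of_not_forall _ hk]

theorem expandsTo_multiHurwitz (φ : ℂ →L[ℝ] ℝ) (k : List ℕ+) :
    ExpandsTo (fun N => φ (multiHurwitz k (N + 1))) (Polynomial.C (φ 1) * leadPoly k) := by
  have hlead : ExpandsTo (fun N => φ (hurwitzLead k (N + 1)))
      (Polynomial.C (φ 1) * leadPoly k) := by
    unfold leadPoly
    convert (expandsTo_const (φ 1)).mul
      ((expandsTo_const (onesExp 1 k)).mul (expandsTo_neg_log_add_one.pow k.length)) using 2 with N
    rw [hurwitzLead_natCast_add_one, ← mul_one ((_ : ℝ) : ℂ), ← Complex.real_smul, map_smul,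
      smul_eq_mul, mul_comm]
  simpa only [map_sub, add_sub_cancel, add_zero] using
    hlead.add (negligible_of_grows (grows_multiHurwitz_sub_lead k) φ).expandsTo_zero

theorem multiHurwitz_one (k : List ℕ+) : multiHurwitz k 1 = (zetaReg k : ℂ) := by
  have happly (φ : ℂ →L[ℝ] ℝ) : φ (multiHurwitz k 1) = φ 1 * zetaReg k := by
    have hconv (N : ℕ) : φ (multiHurwitz k 1) =
        conv (truncSum N 0) (fun l => φ (multiHurwitz l (N + 1))) k := by
      rw [← congrFun (conv_truncSum_multiHurwitz N) k, conv, map_sum]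
      exact Finset.sum_congr rfl fun i _ => by
        rw [← Complex.real_smul, map_smul, smul_eq_mul]
    have hexpands := ExpandsTo.conv expandsTo_truncSum (expandsTo_multiHurwitz φ) k
    simp only [← hconv] at hexpands
    rw [hexpands.eq_eval_zero, eval_zero_conv]
    simp only [Polynomial.eval_mul, Polynomial.eval_C, eval_zero_leadPoly, mul_comm (φ 1)]
    rw [conv_mul_right, conv_unit_right]
    rfl
  exact Complex.ext (by simpa using happly Complex.reCLM) (by simpa using happly Complex.imCLM)

theorem taylorSum_ofReal (F : List ℕ+ → ℝ) (a : ℕ) (k : List ℕ+) :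
    taylorSum (fun l => (F l : ℂ)) a k = ((taylorSum F a k : ℝ) : ℂ) := by
  rw [taylorSum_eq, taylorSum_eq]
  push_cast
  rfl

theorem taylorCoeff_multiHurwitz_one (a : ℕ) (k : List ℕ+) :
    taylorCoeff a (multiHurwitz k) 1 = (zetaTaylor a k : ℂ) := by
  rw [taylorCoeff_multiHurwitz a k (mem_rightHalf.2 (by simp)), zetaTaylor_eq, ← taylorSum_ofReal]
  simp only [multiHurwitz_one]

end HurwitzOne

/-! ### Duality between star values and ordinary values -/

theorem truncSum_self_eq (N : ℕ) : truncSum N N = convUnit := by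
  funext k
  cases k with
  | nil => rfl
  | cons x k => exact truncSum_self N x k

theorem truncSum_cons_eq {N a : ℕ} (ha : a < N) (x : ℕ+) (k : List ℕ+) :
    truncSum N a (x :: k) =
      truncSum N (a + 1) (x :: k) + (((a : ℝ) + 1) ^ (x : ℕ))⁻¹ * truncSum N (a + 1) k := by
  rw [truncSum, truncSum, ← Finset.insert_Ioc_add_one_left_eq_Ioc ha, Finset.sum_insert (by simp)]
  push_cast
  ring

/-- The truncated star sum: `truncSum N a` summed over all mergings, which amounts to the sum over
`a < m₁ ≤ ⋯ ≤ m_d ≤ N`. -/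
noncomputable def truncStar (N a : ℕ) (k : List ℕ+) : ℝ := ((mergings k).map (truncSum N a)).sum

theorem truncStar_nil (N a : ℕ) : truncStar N a [] = 1 := by
  simp [truncStar, mergings, truncSum]

theorem mergingsFrom_ne_nil (x : ℕ+) (k : List ℕ+) : ∀ v ∈ mergingsFrom x k, v ≠ [] := by
  induction k generalizing x with
  | nil => simp [mergingsFrom]
  | cons y k ih =>
    intro v hv
    rcases List.mem_append.1 hv with hv | hv
    · obtain ⟨w, -, rfl⟩ := List.mem_map.1 hv
      exact List.cons_ne_nil x w
    · exact ih _ v hv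

theorem truncStar_self (N : ℕ) : truncStar N N = convUnit := by
  funext k
  cases k with
  | nil => exact truncStar_nil N N
  | cons x k =>
    rw [truncStar, mergings, truncSum_self_eq, convUnit]
    refine List.sum_eq_zero fun r hr => ?_
    obtain ⟨v, hv, rfl⟩ := List.mem_map.1 hr
    obtain ⟨y, l, rfl⟩ := List.exists_cons_of_ne_nil (mergingsFrom_ne_nil x k v hv)
    rfl

theorem truncStar_cons_cons (N a : ℕ) (x y : ℕ+) (k : List ℕ+) : truncStar N a (x :: y :: k) =
    ((mergings (y :: k)).map fun v => truncSum N a (x :: v)).sum +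
      truncStar N a ((x + y) :: k) := by
  simp [truncStar, mergings, mergingsFrom, Function.comp_def]

theorem truncStar_cons_eq {N a : ℕ} (ha : a < N) (x : ℕ+) (k : List ℕ+) :
    truncStar N a (x :: k) =
      truncStar N (a + 1) (x :: k) + (((a : ℝ) + 1) ^ (x : ℕ))⁻¹ * truncStar N a k := by
  induction k generalizing x with
  | nil => simpa [truncStar, mergings, mergingsFrom, truncSum] using truncSum_cons_eq ha x []
  | cons y k ih =>
    have hcomma : ((mergings (y :: k)).map fun v => truncSum N a (x :: v)).sum =
        ((mergings (y :: k)).map fun v => truncSum N (a + 1) (x :: v)).sum +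
          (((a : ℝ) + 1) ^ (x : ℕ))⁻¹ * truncStar N (a + 1) (y :: k) := by
      simp only [truncSum_cons_eq ha, List.sum_map_add, List.sum_map_mul_left, truncStar]
    rw [truncStar_cons_cons, truncStar_cons_cons, hcomma, ih, ih y, PNat.add_coe, pow_add, mul_inv]
    ring

/-- The sign `(-1) ^ d` of a word of length `d`. -/
def lengthSign {R : Type*} [CommRing R] (k : List ℕ+) : R := (-1) ^ k.length

theorem lengthSign_mul_convUnit {R : Type*} [CommRing R] (k : List ℕ+) :
    lengthSign k * convUnit k = (convUnit k : R) := by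
  cases k <;> simp [convUnit, lengthSign]

theorem conv_letterFun_truncStar {N a : ℕ} (ha : a < N) :
    conv (letterFun fun x : ℕ+ => (((a : ℝ) + 1) ^ (x : ℕ))⁻¹)
        (fun l => lengthSign l * truncStar N a l) =
      fun l => lengthSign l * truncStar N (a + 1) l := by
  funext k
  cases k with
  | nil => simp [conv_nil, letterFun, truncStar_nil]
  | cons x k =>
    simp only [conv_letterFun_cons, lengthSign, List.length_cons, truncStar_cons_eq ha]
    ring

theorem conv_truncSum_reverse_letterFun {N a : ℕ} (ha : a < N) :
    conv (fun l => truncSum N (a + 1) l.reverse)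
        (letterFun fun x : ℕ+ => (((a : ℝ) + 1) ^ (x : ℕ))⁻¹) =
      fun l => truncSum N a l.reverse := by
  funext k
  induction k using List.reverseRecOn with
  | nil => simp [conv_nil, truncSum, letterFun]
  | append_singleton k x _ =>
    simp only [conv_letterFun_append, List.reverse_append, List.reverse_singleton,
      List.singleton_append]
    rw [truncSum_cons_eq ha, mul_comm]

theorem conv_truncStar_reverse {N a : ℕ} (ha : a ≤ N) :
    conv (fun l => lengthSign l * truncStar N a l) (fun l => truncSum N a l.reverse) =
      convUnit := by
  induction ha using Nat.decreasingInduction with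
  | self =>
    simp only [truncStar_self, truncSum_self_eq, lengthSign_mul_convUnit, convUnit_reverse]
    exact conv_unit_left convUnit
  | of_succ a ha ih =>
    refine conv_letterFun_left_cancel (u := fun x : ℕ+ => (((a : ℝ) + 1) ^ (x : ℕ))⁻¹) ?_
    rw [← conv_assoc, conv_letterFun_truncStar ha, ← conv_truncSum_reverse_letterFun ha,
      ← conv_assoc, ih, conv_unit_left, conv_unit_right]

theorem eval_zero_sum_regPoly (l : List (List ℕ+)) :
    ((l.map regPoly).sum).eval 0 = (l.map zetaReg).sum := by
  induction l with
  | nil => simp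
  | cons v l ih => simp [ih, zetaReg]

theorem conv_zetaStar_reverse :
    conv (fun l => lengthSign l * zetaStarReg l) (fun l => zetaReg l.reverse) = convUnit := by
  funext k
  have hexpands := ExpandsTo.conv
    (fun l => (expandsTo_const (lengthSign l)).mul
      (ExpandsTo.list_map_sum (mergings l) expandsTo_truncSum))
    (fun l => expandsTo_truncSum l.reverse) k
  have hconst (N : ℕ) : conv (fun l => lengthSign l * ((mergings l).map (truncSum N 0)).sum)
      (fun l => truncSum N 0 l.reverse) k = convUnit k :=
    congrFun (conv_truncStar_reverse (Nat.zero_le N)) k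
  simp only [hconst] at hexpands
  rw [hexpands.eq_eval_zero, eval_zero_conv]
  simp only [Polynomial.eval_mul, Polynomial.eval_C, eval_zero_sum_regPoly]
  rfl

theorem weight_cons (x : ℕ+) (k : List ℕ+) : weight (x :: k) = x + weight k := by
  simp [weight]

theorem weight_append (k l : List ℕ+) : weight (k ++ l) = weight k + weight l := by
  simp [weight]

theorem weight_eq_length {k : List ℕ+} (hk : ∀ x ∈ k, x = 1) : weight k = k.length := by
  induction k with
  | nil => simp [weight]
  | cons x k ih =>
    rw [List.forall_mem_cons] at hk
    rw [weight_cons, hk.1, ih hk.2, PNat.one_coe, List.length_cons, add_comm]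

/-- The sign `(-1) ^ (k₁ + ⋯ + k_d)`. -/
def weightSign {R : Type*} [CommRing R] (k : List ℕ+) : R := (-1) ^ weight k

section WeightSign

variable {R : Type*} [CommRing R]

theorem weightSign_nil : (weightSign [] : R) = 1 := by simp [weightSign, weight]

theorem weightSign_singleton (x : ℕ+) : (weightSign [x] : R) = (-1) ^ (x : ℕ) := by
  simp [weightSign, weight]

theorem weightSign_append (k l : List ℕ+) :
    (weightSign (k ++ l) : R) = weightSign k * weightSign l := by
  simp [weightSign, weight_append, pow_add]

end WeightSign

/-! ### Functions on the strip -/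

/-- The strip `-1 < Re z < 1`. -/
def openStrip : Set ℂ := {z | -1 < z.re ∧ z.re < 1}

/-- The strip `-1 / 2 ≤ Re z ≤ 1 / 2`. -/
def closedStrip : Set ℂ := {z | |z.re| ≤ 1 / 2}

theorem isOpen_openStrip : IsOpen openStrip :=
  (isOpen_lt continuous_const Complex.continuous_re).inter
    (isOpen_lt Complex.continuous_re continuous_const)

theorem isClosed_closedStrip : IsClosed closedStrip :=
  isClosed_le Complex.continuous_re.abs continuous_const

theorem closedStrip_subset_openStrip : closedStrip ⊆ openStrip := fun z hz => by
  have habs := abs_le.1 (show |z.re| ≤ 1 / 2 from hz)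
  constructor <;> linarith

theorem openStrip_mem_nhds_zero : openStrip ∈ 𝓝 (0 : ℂ) :=
  isOpen_openStrip.mem_nhds (by simp [openStrip])

theorem tendsto_mul_I_closedStrip : Tendsto (fun y : ℝ => (y : ℂ) * Complex.I) atTop
    (𝓟 closedStrip ⊓ Bornology.cobounded ℂ) := by
  refine tendsto_inf.2 ⟨tendsto_principal.2 (.of_forall fun y => by simp [closedStrip]),
    tendsto_norm_atTop_iff_cobounded.1 ?_⟩
  simpa using tendsto_abs_atTop_atTop

theorem tendsto_neg_mul_I_closedStrip : Tendsto (fun y : ℝ => -((y : ℂ) * Complex.I)) atTop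
    (𝓟 closedStrip ⊓ Bornology.cobounded ℂ) := by
  refine tendsto_inf.2 ⟨tendsto_principal.2 (.of_forall fun y => by simp [closedStrip]),
    tendsto_norm_atTop_iff_cobounded.1 ?_⟩
  simpa using tendsto_abs_atTop_atTop

/-- A holomorphic function on the strip that grows at most like every positive power, and whose
mean over the two ends `± i ∞` of the imaginary axis is `c`. -/
structure HasStripMean (f : ℂ → ℂ) (c : ℂ) : Prop where
  differentiableOn : DifferentiableOn ℂ f openStrip
  hasOrderLE : HasOrderLE (𝓟 closedStrip) 0 f
  tendsto : Tendsto (fun y : ℝ => f (y * Complex.I) + f (-(y * Complex.I))) atTop (𝓝 (2 * c))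

namespace HasStripMean

variable {f g : ℂ → ℂ} {c d : ℂ}

theorem of_hasOrderLE {r : ℝ} (hf : DifferentiableOn ℂ f openStrip)
    (hr : r < 0) (hfr : HasOrderLE (𝓟 closedStrip) r f) : HasStripMean f 0 where
  differentiableOn := hf
  hasOrderLE := hfr.mono hr.le
  tendsto := by
    simpa using ((hfr.tendsto_zero hr).comp tendsto_mul_I_closedStrip).add
      ((hfr.tendsto_zero hr).comp tendsto_neg_mul_I_closedStrip)

theorem add (hf : HasStripMean f c) (hg : HasStripMean g d) :
    HasStripMean (fun z => f z + g z) (c + d) where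
  differentiableOn := hf.differentiableOn.add hg.differentiableOn
  hasOrderLE := hf.hasOrderLE.add hg.hasOrderLE
  tendsto := by
    rw [mul_add]
    exact (hf.tendsto.add hg.tendsto).congr fun y => by ring

theorem const_mul (a : ℂ) (hf : HasStripMean f c) : HasStripMean (fun z => a * f z) (a * c) where
  differentiableOn := hf.differentiableOn.const_mul a
  hasOrderLE := hf.hasOrderLE.const_mul a
  tendsto := by
    rw [mul_left_comm]
    exact (hf.tendsto.const_mul a).congr fun y => mul_add _ _ _

theorem sub (hf : HasStripMean f c) (hg : HasStripMean g d) :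
    HasStripMean (fun z => f z - g z) (c - d) := by
  simpa [sub_eq_add_neg] using hf.add (hg.const_mul (-1))

theorem finset_sum {ι : Type*} (t : Finset ι) {F : ι → ℂ → ℂ} {m : ι → ℂ}
    (hF : ∀ i ∈ t, HasStripMean (F i) (m i)) :
    HasStripMean (fun z => ∑ i ∈ t, F i z) (∑ i ∈ t, m i) where
  differentiableOn := .fun_sum fun i hi => (hF i hi).differentiableOn
  hasOrderLE := .finset_sum t fun i hi => (hF i hi).hasOrderLE
  tendsto := by
    simpa only [← Finset.sum_add_distrib, Finset.mul_sum] using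
      tendsto_finsetSum t fun i hi => (hF i hi).tendsto

end HasStripMean

theorem deriv_eq_zero_of_hasOrderLE {F : ℂ → ℂ} {r : ℝ} (hr : r < 1) (hF : Differentiable ℂ F)
    (hFr : HasOrderLE ⊤ r F) (z : ℂ) : deriv F z = 0 := by
  obtain ⟨s, hs, hs1⟩ := exists_between (max_lt hr zero_lt_one)
  obtain ⟨hrs, hs0⟩ := max_lt_iff.1 hs
  obtain ⟨C, hC0, hC⟩ := (hFr (s - r) (by linarith)).exists_nonneg
  rw [Asymptotics.isBigOWith_top, add_sub_cancel] at hC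
  have hcauchy : ∀ᶠ R in atTop, ‖deriv F z‖ ≤ C * 2 ^ s * R ^ (-(1 - s)) := by
    filter_upwards [eventually_ge_atTop (1 + ‖z‖)] with R hR
    have hR0 : 0 < R := by linarith [norm_nonneg z]
    have hsphere (w : ℂ) (hw : w ∈ Metric.sphere z R) : ‖F w‖ ≤ C * (2 * R) ^ s := by
      refine (hC w).trans ?_
      rw [Real.norm_of_nonneg (by positivity)]
      gcongr
      linarith [norm_le_norm_add_norm_sub' w z, mem_sphere_iff_norm.1 hw]
    refine (Complex.norm_deriv_le_of_forall_mem_sphere_norm_le hR0 hF.diffContOnCl hsphere).trans_eq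
      ?_
    rw [neg_sub, Real.rpow_sub_one hR0.ne', Real.mul_rpow two_pos.le hR0.le]
    ring
  have hlim := (tendsto_rpow_neg_atTop (sub_pos.2 hs1)).const_mul (C * 2 ^ s)
  rw [mul_zero] at hlim
  exact norm_le_zero_iff.1 (ge_of_tendsto hlim hcauchy)

theorem apply_eq_apply_of_hasOrderLE {F : ℂ → ℂ} {r : ℝ} (hr : r < 1) (hF : Differentiable ℂ F)
    (hFr : HasOrderLE ⊤ r F) (z w : ℂ) : F z = F w :=
  is_const_of_deriv_eq_zero hF (deriv_eq_zero_of_hasOrderLE hr hF hFr) z w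

/-- The extension of a function on the strip that is periodic with period `1`. -/
noncomputable def periodicExtension (f : ℂ → ℂ) (z : ℂ) : ℂ := f (z - (round z.re : ℤ))

theorem periodicExtension_eq {f : ℂ → ℂ} (hf : ∀ z : ℂ, -1 < z.re → z.re < 0 → f (z + 1) = f z)
    {z : ℂ} {n : ℤ} (hz : z - n ∈ openStrip) : periodicExtension f z = f (z - n) := by
  obtain ⟨hlower, hupper⟩ := hz
  rw [Complex.sub_re, Complex.intCast_re] at hlower hupper
  have hround := abs_le.1 (abs_sub_round z.re)
  rw [periodicExtension]
  generalize round z.re = m at hround ⊢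
  have hmn : m < n + 2 ∧ n < m + 2 := by
    constructor <;> rify <;> linarith
  obtain rfl | rfl | rfl : m = n ∨ m = n + 1 ∨ n = m + 1 := by omega
  · rfl
  · push_cast at hround ⊢
    rw [← hf _ (by simp; linarith) (by simp; linarith)]
    ring_nf
  · push_cast at hlower hupper ⊢
    rw [← hf (z - (m + 1)) (by simp; linarith) (by simp; linarith)]
    ring_nf

theorem differentiable_periodicExtension {f : ℂ → ℂ} (hfd : DifferentiableOn ℂ f openStrip)
    (hf : ∀ z : ℂ, -1 < z.re → z.re < 0 → f (z + 1) = f z) :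
    Differentiable ℂ (periodicExtension f) := fun z => by
  set n : ℤ := round z.re
  have hmem : z - n ∈ openStrip :=
    closedStrip_subset_openStrip (by simpa [closedStrip] using abs_sub_round z.re)
  have hlocal : periodicExtension f =ᶠ[𝓝 z] fun w => f (w - n) := by
    filter_upwards [(isOpen_openStrip.preimage (continuous_sub_right (n : ℂ))).mem_nhds hmem]
      with w hw using periodicExtension_eq hf hw
  refine DifferentiableAt.congr_of_eventuallyEq ?_ hlocal
  exact (hfd.differentiableAt (isOpen_openStrip.mem_nhds hmem)).comp z
    (differentiableAt_id.sub_const (n : ℂ))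

theorem hasOrderLE_periodicExtension {f : ℂ → ℂ} (hf : HasOrderLE (𝓟 closedStrip) 0 f) :
    HasOrderLE ⊤ 0 (periodicExtension f) := fun ε hε => by
  have hmem (z : ℂ) : z - (round z.re : ℤ) ∈ closedStrip := by
    simpa [closedStrip] using abs_sub_round z.re
  refine ((hf ε hε).comp_tendsto (tendsto_principal.2 (.of_forall hmem))).trans
    (Asymptotics.isBigO_top.2 ⟨2 ^ ε, fun z => ?_⟩)
  have hnorm : ‖z - (round z.re : ℤ)‖ ≤ 1 / 2 + ‖z‖ := by
    refine (Complex.norm_le_abs_re_add_abs_im _).trans (add_le_add (hmem z) ?_)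
    simpa using Complex.abs_im_le_norm z
  simp only [Function.comp_apply, zero_add]
  rw [Real.norm_of_nonneg (by positivity), Real.norm_of_nonneg (by positivity),
    ← Real.mul_rpow two_pos.le (by positivity)]
  gcongr
  linarith [norm_nonneg z]

theorem HasStripMean.apply_zero_of_periodic {f : ℂ → ℂ} {c : ℂ} (hf : HasStripMean f c)
    (hperiodic : ∀ z : ℂ, -1 < z.re → z.re < 0 → f (z + 1) = f z) : f 0 = c := by
  have hconst (z : ℂ) (hz : z.re = 0) : f z = f 0 := by
    simpa [periodicExtension, hz] using apply_eq_apply_of_hasOrderLE zero_lt_one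
      (differentiable_periodicExtension hf.differentiableOn hperiodic)
      (hasOrderLE_periodicExtension hf.hasOrderLE) z 0
  have hlim : Tendsto (fun _ : ℝ => 2 * f 0) atTop (𝓝 (2 * c)) :=
    hf.tendsto.congr fun y => by rw [hconst (y * _) (by simp), hconst (-_) (by simp), two_mul]
  exact mul_left_cancel₀ two_ne_zero (tendsto_nhds_unique tendsto_const_nhds hlim)

/-! ### Division by powers of the variable -/

theorem hasOrderLE_of_isCompact {E 𝕜 : Type*} [SeminormedAddCommGroup E] [NormedField 𝕜]
    {K : Set E} (hK : IsCompact K) {f : E → 𝕜} (hf : ContinuousOn f K) (r : ℝ) :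
    HasOrderLE (𝓟 K) r f := by
  have hgauge : ContinuousOn (fun x : E => (1 + ‖x‖) ^ r) K :=
    (Continuous.rpow_const (by fun_prop) fun x => .inl (by positivity)).continuousOn
  exact hasOrderLE_of_isBigO <| (hf.isBigO_principal hK (c := (1 : ℝ)) (by simp)).trans <|
    hgauge.isBigO_rev_principal hK (fun x _ => (by positivity : (1 + ‖x‖) ^ r ≠ 0)) 1

theorem hasOrderLE_dslope {g : ℂ → ℂ} (hg : DifferentiableOn ℂ g openStrip)
    (hgr : HasOrderLE (𝓟 closedStrip) 0 g) : HasOrderLE (𝓟 closedStrip) (-1) (dslope g 0) := by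
  have hnear : HasOrderLE (𝓟 (closedStrip ∩ Metric.closedBall 0 1)) (-1) (dslope g 0) :=
    hasOrderLE_of_isCompact ((isCompact_closedBall 0 1).inter_left isClosed_closedStrip)
      (((Complex.differentiableOn_dslope openStrip_mem_nhds_zero).2 hg).continuousOn.mono
        fun z hz => closedStrip_subset_openStrip hz.1) _
  have hfar : HasOrderLE (𝓟 (closedStrip ∩ {z | 1 ≤ ‖z‖})) (-1) (dslope g 0) := by
    have hinv : HasOrderLE (𝓟 (closedStrip ∩ {z | 1 ≤ ‖z‖})) (-1) fun z : ℂ => z⁻¹ := by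
      refine hasOrderLE_of_isBigO (Asymptotics.isBigO_principal.2 ⟨2, fun z hz => ?_⟩)
      have hz1 : 1 ≤ ‖z‖ := hz.2
      rw [Real.rpow_neg_one, norm_inv, norm_inv, Real.norm_of_nonneg (by positivity),
        inv_le_comm₀ (by positivity) (by positivity), mul_inv, inv_inv]
      linarith
    have hsub := (hgr.mono_filter (principal_mono.2 Set.inter_subset_left)).sub
      (hasOrderLE_const (𝓟 (closedStrip ∩ {z | 1 ≤ ‖z‖})) (g 0))
    intro ε hε
    refine ((hinv.mul hsub) ε hε).congr' ?_ (by simp)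
    refine eventually_principal.2 fun z hz => ?_
    have hz0 : z ≠ 0 := norm_pos_iff.1 (zero_lt_one.trans_le hz.2)
    rw [dslope_of_ne _ hz0, slope_def_field, sub_zero]
    exact inv_mul_eq_div _ _
  have hsplit : closedStrip =
      closedStrip ∩ Metric.closedBall 0 1 ∪ closedStrip ∩ {z | 1 ≤ ‖z‖} := by
    rw [← Set.inter_union_distrib_left, eq_comm, Set.inter_eq_left]
    exact fun z _ => by simpa using le_total ‖z‖ 1
  rw [hsplit, ← sup_principal]
  exact fun ε hε => (hnear ε hε).sup (hfar ε hε)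

/-- The quotient by `z ^ n` of the remainder of the Taylor expansion of `g` at `0` to order `n`,
with the singularity at `0` removed. -/
noncomputable def taylorRemainder (n : ℕ) (g : ℂ → ℂ) : ℂ → ℂ := (fun h => dslope h 0)^[n] g

theorem taylorRemainder_succ (n : ℕ) (g : ℂ → ℂ) :
    taylorRemainder (n + 1) g = taylorRemainder n (dslope g 0) := rfl

theorem analyticAt_dslope {g : ℂ → ℂ} (hg : AnalyticAt ℂ g 0) : AnalyticAt ℂ (dslope g 0) 0 :=
  hg.hasFPowerSeriesAt.has_fpower_series_dslope_fslope.analyticAt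

theorem taylorCoeff_dslope (n : ℕ) {g : ℂ → ℂ} (hg : AnalyticAt ℂ g 0) :
    taylorCoeff n (dslope g 0) 0 = taylorCoeff (n + 1) g 0 := by
  have hseries := (analyticAt_dslope hg).hasFPowerSeriesAt.eq_formalMultilinearSeries
    hg.hasFPowerSeriesAt.has_fpower_series_dslope_fslope
  have hcoeff := congrArg (FormalMultilinearSeries.coeff · n) hseries
  simpa only [taylorCoeff, FormalMultilinearSeries.coeff_fslope,
    FormalMultilinearSeries.coeff_ofScalars] using hcoeff

theorem differentiableOn_taylorRemainder (n : ℕ) {g : ℂ → ℂ} (hg : DifferentiableOn ℂ g openStrip) :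
    DifferentiableOn ℂ (taylorRemainder n g) openStrip := by
  induction n generalizing g with
  | zero => exact hg
  | succ _ ih => exact ih ((Complex.differentiableOn_dslope openStrip_mem_nhds_zero).2 hg)

theorem hasOrderLE_taylorRemainder (n : ℕ) {g : ℂ → ℂ} (hg : DifferentiableOn ℂ g openStrip)
    (hgr : HasOrderLE (𝓟 closedStrip) 0 g) :
    HasOrderLE (𝓟 closedStrip) (-1) (taylorRemainder (n + 1) g) := by
  induction n generalizing g with
  | zero => exact hasOrderLE_dslope hg hgr
  | succ _ ih =>
    exact ih ((Complex.differentiableOn_dslope openStrip_mem_nhds_zero).2 hg)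
      ((hasOrderLE_dslope hg hgr).mono (by norm_num))

theorem hasStripMean_taylorRemainder {n : ℕ} (hn : n ≠ 0) {g : ℂ → ℂ}
    (hg : DifferentiableOn ℂ g openStrip) (hgr : HasOrderLE (𝓟 closedStrip) 0 g) :
    HasStripMean (taylorRemainder n g) 0 := by
  obtain ⟨n, rfl⟩ := Nat.exists_eq_succ_of_ne_zero hn
  exact .of_hasOrderLE (differentiableOn_taylorRemainder _ hg) (by norm_num)
    (hasOrderLE_taylorRemainder n hg hgr)

theorem taylorRemainder_zero (n : ℕ) {g : ℂ → ℂ} (hg : AnalyticAt ℂ g 0) :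
    taylorRemainder n g 0 = taylorCoeff n g 0 := by
  induction n generalizing g with
  | zero => exact (taylorCoeff_zero g 0).symm
  | succ n ih =>
    rw [taylorRemainder_succ, ih (analyticAt_dslope hg), taylorCoeff_dslope n hg]

theorem taylorRemainder_of_ne_zero (n : ℕ) {g : ℂ → ℂ} (hg : AnalyticAt ℂ g 0) {z : ℂ}
    (hz : z ≠ 0) : taylorRemainder n g z =
      (z ^ n)⁻¹ * g z - ∑ t ∈ Finset.range n, taylorCoeff t g 0 * (z ^ (n - t))⁻¹ := by
  induction n generalizing g with
  | zero => simp [taylorRemainder]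
  | succ n ih =>
    rw [taylorRemainder_succ, ih (analyticAt_dslope hg), Finset.sum_range_succ', dslope_of_ne _ hz,
      slope_def_field, taylorCoeff_zero]
    simp only [taylorCoeff_dslope _ hg, Nat.add_sub_add_right, Nat.sub_zero, sub_zero]
    field_simp
    ring

/-! ### Multitangent functions -/

/-- The contribution of the positive integers to a multitangent function. -/
noncomputable def posPart (z : ℂ) (k : List ℕ+) : ℂ := multiHurwitz k (1 + z)

/-- The contribution of the negative integers to a multitangent function. -/
noncomputable def negPart (z : ℂ) (k : List ℕ+) : ℂ :=
  weightSign k * multiHurwitz k.reverse (1 - z)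

/-- The multitangent function without the summands that involve the integer `0`. -/
noncomputable def multitangentAway (k : List ℕ+) (z : ℂ) : ℂ := conv (negPart z) (posPart z) k

/-- The regularized multitangent function
`∑_{n₁ < ⋯ < n_d} 1 / ((z + n₁) ^ k₁ ⋯ (z + n_d) ^ k_d)` over all integers. -/
noncomputable def multitangent (k : List ℕ+) (z : ℂ) : ℂ :=
  conv (negPart z) (conv (point z) (posPart z)) k

/-- The cofactor of `z ^ (-x)` in the multitangent function of `u ++ x :: v`. -/
noncomputable def sideProduct (u v : List ℕ+) (z : ℂ) : ℂ := negPart z u * posPart z v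

theorem one_add_mem_rightHalf {z : ℂ} (hz : z ∈ openStrip) : 1 + z ∈ rightHalf := by
  simpa [mem_rightHalf, neg_lt_iff_pos_add'] using hz.1

theorem one_sub_mem_rightHalf {z : ℂ} (hz : z ∈ openStrip) : 1 - z ∈ rightHalf := by
  simpa [mem_rightHalf] using hz.2

theorem differentiableOn_posPart (k : List ℕ+) :
    DifferentiableOn ℂ (fun z => posPart z k) openStrip :=
  (differentiableOn_multiHurwitz k).comp (by fun_prop) fun _ hz => one_add_mem_rightHalf hz

theorem differentiableOn_negPart (k : List ℕ+) :
    DifferentiableOn ℂ (fun z => negPart z k) openStrip :=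
  ((differentiableOn_multiHurwitz k.reverse).comp (by fun_prop)
    fun _ hz => one_sub_mem_rightHalf hz).const_mul _

theorem differentiableOn_multitangentAway (k : List ℕ+) :
    DifferentiableOn ℂ (multitangentAway k) openStrip :=
  .fun_sum (u := Finset.range (k.length + 1)) fun i _ =>
    (differentiableOn_negPart (k.take i)).mul (differentiableOn_posPart (k.drop i))

theorem differentiableOn_sideProduct (u v : List ℕ+) :
    DifferentiableOn ℂ (sideProduct u v) openStrip :=
  (differentiableOn_negPart u).mul (differentiableOn_posPart v)

theorem multitangent_eq (k : List ℕ+) (z : ℂ) : multitangent k z = multitangentAway k z +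
    ∑ j : Fin k.length, (z ^ (k.get j : ℕ))⁻¹ * sideProduct (k.take j) (k.drop (j + 1)) z := by
  rw [multitangent, point, conv_letterFun_middle, multitangentAway]
  congr 1
  exact Finset.sum_congr rfl fun j _ => by rw [sideProduct]; ring

theorem negPart_nil (z : ℂ) : negPart z [] = 1 := by
  simp [negPart, multiHurwitz, weightSign_nil]

theorem posPart_nil (z : ℂ) : posPart z [] = 1 := by
  simp [posPart, multiHurwitz]

theorem multitangent_singleton (x : ℕ+) (z : ℂ) :
    multitangent [x] z = multitangentAway [x] z + (z ^ (x : ℕ))⁻¹ := by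
  rw [multitangent_eq]
  simp [sideProduct, negPart_nil, posPart_nil]

theorem posPart_eq_conv {z : ℂ} (hz : z + 1 ∈ rightHalf) :
    posPart z = conv (point (z + 1)) (posPart (z + 1)) := by
  have hshift (v : ℂ) : posPart v = fun k => multiHurwitz k (v + 1) :=
    funext fun k => by rw [posPart, add_comm]
  rw [hshift, hshift]
  exact multiHurwitz_eq_conv hz

theorem negPart_add_one {z : ℂ} (hz : -z ∈ rightHalf) :
    negPart (z + 1) = conv (negPart z) (point z) := by
  funext k
  induction k using List.reverseRecOn with
  | nil => simp [negPart_nil, conv_nil, point, letterFun]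
  | append_singleton k x _ =>
    have hsign : (weightSign [x] : ℂ) * ((-z) ^ (x : ℕ))⁻¹ = (z ^ (x : ℕ))⁻¹ := by
      rw [weightSign_singleton, neg_pow z, mul_inv, mul_inv_cancel_left₀ (by simp)]
    rw [point, conv_letterFun_append, ← hsign, negPart, negPart, negPart, weightSign_append,
      List.reverse_append, List.reverse_singleton, List.singleton_append,
      show (1 : ℂ) - (z + 1) = -z by ring, multiHurwitz_cons_eq x _ hz,
      show -z + 1 = 1 - z by ring]
    ring

theorem multitangent_add_one (k : List ℕ+) {z : ℂ} (hlower : -1 < z.re) (hupper : z.re < 0) :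
    multitangent k (z + 1) = multitangent k z := by
  have hneg : -z ∈ rightHalf := by simpa [mem_rightHalf] using hupper
  have hpos : z + 1 ∈ rightHalf := by simpa [mem_rightHalf, neg_lt_iff_pos_add] using hlower
  rw [multitangent, multitangent, posPart_eq_conv hpos, negPart_add_one hneg, conv_assoc]

theorem weightSign_mul_onesExp {K : Type*} [Field K] (a : K) (k : List ℕ+) :
    weightSign k * onesExp a k = onesExp (-a) k := by
  by_cases hk : ∀ x ∈ k, x = 1
  · rw [onesExp_of_forall _ hk, onesExp_of_forall _ hk, weightSign, weight_eq_length hk, neg_pow a]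
    ring
  · rw [onesExp_of_not_forall _ hk, onesExp_of_not_forall _ hk, mul_zero]

theorem one_add_mem_halfPlane {z : ℂ} (hz : z ∈ closedStrip) : 1 + z ∈ halfPlane := by
  have habs := abs_le.1 (show |z.re| ≤ 1 / 2 from hz)
  rw [mem_halfPlane, Complex.add_re, Complex.one_re]
  linarith

theorem one_sub_mem_halfPlane {z : ℂ} (hz : z ∈ closedStrip) : 1 - z ∈ halfPlane := by
  have habs := abs_le.1 (show |z.re| ≤ 1 / 2 from hz)
  rw [mem_halfPlane, Complex.sub_re, Complex.one_re]
  linarith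

theorem HasOrderLE.comp_one_add {r : ℝ} {g : ℂ → ℂ} (hg : Grows r g) :
    HasOrderLE (𝓟 closedStrip) r fun z => g (1 + z) :=
  hg.comp_isometry (isometry_add_left 1) <| tendsto_principal_principal.2 fun _ hz =>
    one_add_mem_halfPlane hz

theorem HasOrderLE.comp_one_sub {r : ℝ} {g : ℂ → ℂ} (hg : Grows r g) :
    HasOrderLE (𝓟 closedStrip) r fun z => g (1 - z) :=
  hg.comp_isometry (IsometryEquiv.subLeft 1).isometry <| tendsto_principal_principal.2 fun _ hz =>
    one_sub_mem_halfPlane hz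

theorem hasOrderLE_posPart (k : List ℕ+) : HasOrderLE (𝓟 closedStrip) 0 fun z => posPart z k :=
  (grows_multiHurwitz k).comp_one_add

theorem hasOrderLE_negPart (k : List ℕ+) : HasOrderLE (𝓟 closedStrip) 0 fun z => negPart z k :=
  (grows_multiHurwitz k.reverse).comp_one_sub.const_mul _

theorem hasOrderLE_sideProduct (u v : List ℕ+) :
    HasOrderLE (𝓟 closedStrip) 0 (sideProduct u v) := by
  rw [← add_zero (0 : ℝ)]
  exact (hasOrderLE_negPart u).mul (hasOrderLE_posPart v)

theorem hasOrderLE_posPart_sub (k : List ℕ+) : HasOrderLE (𝓟 closedStrip) (-1) fun z =>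
    posPart z k - onesExp (negLogGamma (1 + z)) k :=
  (grows_multiHurwitz_sub_lead k).comp_one_add

theorem hasOrderLE_negPart_sub (k : List ℕ+) : HasOrderLE (𝓟 closedStrip) (-1) fun z =>
    negPart z k - onesExp (-negLogGamma (1 - z)) k :=
  ((grows_multiHurwitz_sub_lead k.reverse).comp_one_sub.const_mul (weightSign k)).congr fun z => by
    rw [mul_sub, negPart, hurwitzLead, onesExp_reverse, weightSign_mul_onesExp]

theorem hasOrderLE_multitangentAway_sub (k : List ℕ+) : HasOrderLE (𝓟 closedStrip) (-1) fun z =>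
    multitangentAway k z - onesExp (Complex.log (1 - z) - Complex.log (1 + z)) k := by
  have hterm (i : ℕ) : HasOrderLE (𝓟 closedStrip) (-1) fun z =>
      (negPart z (k.take i) - onesExp (-negLogGamma (1 - z)) (k.take i)) * posPart z (k.drop i) +
        onesExp (-negLogGamma (1 - z)) (k.take i) *
          (posPart z (k.drop i) - onesExp (negLogGamma (1 + z)) (k.drop i)) := by
    have hlead : HasOrderLE (𝓟 closedStrip) 0 fun z => -negLogGamma (1 - z) := by
      simpa using grows_negLogGamma.comp_one_sub.const_mul (-1)
    simpa using ((hasOrderLE_negPart_sub (k.take i)).mul (hasOrderLE_posPart (k.drop i))).add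
      (by simpa using (hasOrderLE_onesExp hlead (k.take i)).mul (hasOrderLE_posPart_sub (k.drop i)))
  refine (HasOrderLE.finset_sum (Finset.range (k.length + 1)) fun i _ => hterm i).congr fun z => ?_
  have hlog : Complex.log (1 - z) - Complex.log (1 + z) =
      -negLogGamma (1 - z) + negLogGamma (1 + z) := by
    simp only [negLogGamma]
    ring
  rw [hlog, ← conv_onesExp, multitangentAway, conv, conv, ← Finset.sum_sub_distrib]
  exact Finset.sum_congr rfl fun i _ => by ring

theorem hasOrderLE_multitangentAway (k : List ℕ+) :
    HasOrderLE (𝓟 closedStrip) 0 (multitangentAway k) := by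
  rw [← add_zero (0 : ℝ)]
  exact HasOrderLE.finset_sum (Finset.range (k.length + 1)) fun i _ =>
    (hasOrderLE_negPart (k.take i)).mul (hasOrderLE_posPart (k.drop i))

theorem tendsto_arg_one_add_mul_I :
    Tendsto (fun y : ℝ => Complex.arg (1 + y * Complex.I)) atTop (𝓝 (Real.pi / 2)) := by
  have hlim : Tendsto (fun y : ℝ => ((y⁻¹ : ℝ) : ℂ) + Complex.I) atTop (𝓝 Complex.I) := by
    simpa using ((Complex.continuous_ofReal.tendsto 0).comp tendsto_inv_atTop_zero).add_const
      Complex.I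
  have harg := (Complex.continuousAt_arg (.inr (by simp))).tendsto.comp hlim
  rw [Complex.arg_I] at harg
  refine harg.congr' ?_
  filter_upwards [eventually_gt_atTop 0] with y hy
  have hy0 : (y : ℂ) ≠ 0 := Complex.ofReal_ne_zero.2 hy.ne'
  rw [Function.comp_apply, ← Complex.arg_real_mul _ hy, mul_add, Complex.ofReal_inv,
    mul_inv_cancel₀ hy0]

theorem tendsto_log_sub_log : Tendsto (fun y : ℝ =>
    Complex.log (1 - y * Complex.I) - Complex.log (1 + y * Complex.I)) atTop
    (𝓝 (-(Real.pi * Complex.I))) := by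
  have hlim := ((Complex.continuous_ofReal.tendsto _).comp tendsto_arg_one_add_mul_I).const_mul
    (-(2 * Complex.I))
  rw [show -(2 * Complex.I) * ((Real.pi / 2 : ℝ) : ℂ) = -(Real.pi * Complex.I) by push_cast; ring]
    at hlim
  refine hlim.congr fun y => ?_
  have hconj : (1 : ℂ) - y * Complex.I = (starRingEnd ℂ) (1 + y * Complex.I) := by
    simp [sub_eq_add_neg]
  have harg : Complex.arg (1 + y * Complex.I) ≠ Real.pi := fun h => by
    have hre := (Complex.arg_eq_pi_iff.1 h).1
    norm_num at hre
  rw [hconj, Complex.log_conj _ harg]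
  apply Complex.ext <;> simp [Complex.log_im]
  ring

theorem deltaTerm_of_not_forall {k : List ℕ+} (hk : ¬ ∀ x ∈ k, x = 1) : deltaTerm k = 0 :=
  if_neg fun h => hk (List.eq_replicate_length.1 h.2)

theorem onesExp_add_onesExp_neg (k : List ℕ+) :
    onesExp (Real.pi * Complex.I) k + onesExp (-(Real.pi * Complex.I)) k =
      2 * (deltaTerm k : ℂ) := by
  by_cases hk : ∀ x ∈ k, x = 1
  · rw [onesExp_of_forall _ hk, onesExp_of_forall _ hk, deltaTerm]
    rcases Nat.even_or_odd k.length with heven | hodd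
    · have hI : Complex.I ^ k.length = (-1) ^ (k.length / 2) := by
        rw [← Complex.I_sq, ← pow_mul, Nat.two_mul_div_two_of_even heven]
      rw [if_pos ⟨heven, List.eq_replicate_length.2 hk⟩, heven.neg_pow, mul_pow, hI]
      push_cast
      ring
    · rw [if_neg fun h => Nat.not_even_iff_odd.2 hodd h.1, hodd.neg_pow]
      simp [neg_div]
  · rw [onesExp_of_not_forall _ hk, onesExp_of_not_forall _ hk, deltaTerm_of_not_forall hk]
    simp

theorem continuous_onesExp (k : List ℕ+) : Continuous fun a : ℂ => onesExp a k :=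
  (continuous_const.mul (continuous_pow k.length)).congr fun a => (onesExp_eq a k).symm

theorem hasStripMean_multitangentAway (k : List ℕ+) :
    HasStripMean (multitangentAway k) (deltaTerm k) where
  differentiableOn := differentiableOn_multitangentAway k
  hasOrderLE := hasOrderLE_multitangentAway k
  tendsto := by
    have hsub := (hasOrderLE_multitangentAway_sub k).tendsto_zero neg_one_lt_zero
    have hpos := (hsub.comp tendsto_mul_I_closedStrip).add
      ((continuous_onesExp k).tendsto _ |>.comp tendsto_log_sub_log)
    have hneg := (hsub.comp tendsto_neg_mul_I_closedStrip).add
      ((continuous_onesExp k).tendsto _ |>.comp tendsto_log_sub_log.neg)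
    have hlim := hpos.add hneg
    rw [neg_neg, zero_add, zero_add, add_comm, onesExp_add_onesExp_neg] at hlim
    refine hlim.congr fun y => ?_
    simp only [Function.comp_apply, neg_sub, sub_neg_eq_add, ← sub_eq_add_neg]
    ring

theorem deltaTerm_singleton (x : ℕ+) : deltaTerm [x] = 0 :=
  if_neg fun h => absurd h.1 (by simp)

/-! ### Reduction of multitangent functions to monotangent functions -/

theorem contDiffAt_posPart (k : List ℕ+) (n : WithTop ℕ∞) :
    ContDiffAt ℂ n (fun z => posPart z k) 0 :=
  ((differentiableOn_posPart k).analyticAt openStrip_mem_nhds_zero).contDiffAt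

theorem contDiffAt_negPart (k : List ℕ+) (n : WithTop ℕ∞) :
    ContDiffAt ℂ n (fun z => negPart z k) 0 :=
  ((differentiableOn_negPart k).analyticAt openStrip_mem_nhds_zero).contDiffAt

theorem analyticAt_sideProduct (u v : List ℕ+) : AnalyticAt ℂ (sideProduct u v) 0 :=
  (differentiableOn_sideProduct u v).analyticAt openStrip_mem_nhds_zero

theorem taylorCoeff_posPart (a : ℕ) (k : List ℕ+) :
    taylorCoeff a (fun z => posPart z k) 0 = (zetaTaylor a k : ℂ) := by
  simp only [posPart, add_comm (1 : ℂ)]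
  rw [taylorCoeff_comp_add_const, zero_add, taylorCoeff_multiHurwitz_one]

theorem taylorCoeff_negPart (a : ℕ) (k : List ℕ+) : taylorCoeff a (fun z => negPart z k) 0 =
    weightSign k * (-1) ^ a * (zetaTaylor a k.reverse : ℂ) := by
  simp only [negPart]
  rw [taylorCoeff_const_mul, ← taylorCoeff_multiHurwitz_one, taylorCoeff, taylorCoeff,
    iteratedDeriv_comp_const_sub]
  beta_reduce
  rw [sub_zero, smul_eq_mul]
  ring

/-- The Taylor coefficients of `sideProduct` at `0`. -/
noncomputable def sideCoeff (u v : List ℕ+) (t : ℕ) : ℝ :=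
  ∑ p ∈ antidiagonal t,
    weightSign u * (-1) ^ p.1 * zetaTaylor p.1 u.reverse * zetaTaylor p.2 v

theorem taylorCoeff_sideProduct (u v : List ℕ+) (t : ℕ) :
    taylorCoeff t (sideProduct u v) 0 = (sideCoeff u v t : ℂ) := by
  have hmul := taylorCoeff_mul (contDiffAt_negPart u t) (contDiffAt_posPart v t)
  simp only [taylorCoeff_negPart, taylorCoeff_posPart] at hmul
  rw [sideCoeff]
  push_cast [weightSign]
  exact hmul

/-- The finite symmetric sums `∑ᵢ (-1) ^ (k₁ + ⋯ + kᵢ) ζ^*(kᵢ, …, k₁) ζ^*(kᵢ₊₁, …, k_d)`. -/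
noncomputable def symmetricSum (k : List ℕ+) : ℝ :=
  conv (fun l => weightSign l * zetaReg l.reverse) zetaReg k

theorem multitangentAway_zero (k : List ℕ+) : multitangentAway k 0 = (symmetricSum k : ℂ) := by
  simp only [multitangentAway, symmetricSum, conv, negPart, posPart, sub_zero, add_zero,
    multiHurwitz_one, weightSign]
  push_cast
  rfl

/-- The summand `z ^ (-n) * sideProduct u v z` of a multitangent function minus the combination of
monotangent functions with the same principal part at `0`, extended analytically to `0`. -/
noncomputable def poleDefect (n : ℕ) (u v : List ℕ+) (z : ℂ) : ℂ :=
  taylorRemainder n (sideProduct u v) z - ∑ t ∈ Finset.range n,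
    sideCoeff u v t * multitangentAway [Nat.succPNat (n - 1 - t)] z

theorem poleDefect_of_ne_zero (n : ℕ) (u v : List ℕ+) {z : ℂ} (hz : z ≠ 0) :
    poleDefect n u v z = (z ^ n)⁻¹ * sideProduct u v z - ∑ t ∈ Finset.range n,
      sideCoeff u v t * multitangent [Nat.succPNat (n - 1 - t)] z := by
  rw [poleDefect, taylorRemainder_of_ne_zero n (analyticAt_sideProduct u v) hz, sub_sub,
    ← Finset.sum_add_distrib]
  congr 1
  refine Finset.sum_congr rfl fun t ht => ?_
  have hexp : (Nat.succPNat (n - 1 - t) : ℕ) = n - t := by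
    have ht' := Finset.mem_range.1 ht
    rw [Nat.succPNat_coe]
    omega
  rw [multitangent_singleton, taylorCoeff_sideProduct, hexp]
  ring

theorem hasStripMean_poleDefect {n : ℕ} (hn : n ≠ 0) (u v : List ℕ+) :
    HasStripMean (poleDefect n u v) 0 := by
  have hremainder := hasStripMean_taylorRemainder hn (differentiableOn_sideProduct u v)
    (hasOrderLE_sideProduct u v)
  have hmono (x : ℕ+) : HasStripMean (multitangentAway [x]) 0 := by
    simpa [deltaTerm_singleton] using hasStripMean_multitangentAway [x]
  have hdefect : HasStripMean (poleDefect n u v) _ :=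
    hremainder.sub (.finset_sum (Finset.range n) fun t _ => (hmono _).const_mul (sideCoeff u v t))
  simpa using hdefect

/-- A multitangent function minus its reduction to monotangent functions, extended analytically
to `0`. -/
noncomputable def multitangentDefect (k : List ℕ+) (z : ℂ) : ℂ :=
  multitangentAway k z + ∑ j : Fin k.length, poleDefect (k.get j) (k.take j) (k.drop (j + 1)) z

theorem multitangentDefect_of_ne_zero (k : List ℕ+) {z : ℂ} (hz : z ≠ 0) :
    multitangentDefect k z = multitangent k z - ∑ j : Fin k.length,
      ∑ t ∈ Finset.range (k.get j), sideCoeff (k.take j) (k.drop (j + 1)) t *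
        multitangent [Nat.succPNat ((k.get j : ℕ) - 1 - t)] z := by
  simp only [multitangentDefect, poleDefect_of_ne_zero _ _ _ hz, Finset.sum_sub_distrib]
  rw [multitangent_eq, add_sub_assoc]

theorem multitangentDefect_add_one (k : List ℕ+) {z : ℂ} (hlower : -1 < z.re)
    (hupper : z.re < 0) : multitangentDefect k (z + 1) = multitangentDefect k z := by
  have hz : z ≠ 0 := fun h => by simp [h] at hupper
  have hz1 : z + 1 ≠ 0 := fun h => by simp [eq_neg_of_add_eq_zero_left h] at hlower
  rw [multitangentDefect_of_ne_zero k hz, multitangentDefect_of_ne_zero k hz1]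
  simp only [multitangent_add_one _ hlower hupper]

theorem hasStripMean_multitangentDefect (k : List ℕ+) :
    HasStripMean (multitangentDefect k) (deltaTerm k) := by
  have hdefect : HasStripMean (multitangentDefect k) _ := (hasStripMean_multitangentAway k).add
    (.finset_sum Finset.univ fun j _ => hasStripMean_poleDefect (k.get j).ne_zero _ _)
  simpa using hdefect

theorem multitangentDefect_zero (k : List ℕ+) : multitangentDefect k 0 = deltaTerm k :=
  (hasStripMean_multitangentDefect k).apply_zero_of_periodic fun _ => multitangentDefect_add_one k

/-- The coefficients of the power series `π z cot (π z) = ∑ₑ cotCoeff e * z ^ e`. -/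
noncomputable def cotCoeff (e : ℕ) : ℝ :=
  if Even e then (-1) ^ (e / 2) * (2 * Real.pi) ^ e / e.factorial * bernoulli e else 0

theorem cotCoeff_zero : cotCoeff 0 = 1 := by simp [cotCoeff]

theorem cotCoeff_two_mul (m : ℕ) : cotCoeff (2 * m) =
    (-1) ^ m * (2 * Real.pi) ^ (2 * m) / (2 * m).factorial * bernoulli (2 * m) := by
  rw [cotCoeff, if_pos (even_two_mul m), Nat.mul_div_cancel_left m two_pos]

theorem cotCoeff_of_odd {e : ℕ} (he : Odd e) : cotCoeff e = 0 :=
  if_neg (Nat.not_even_iff_odd.2 he)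

theorem two_mul_zetaReg_singleton {x : ℕ+} {m : ℕ} (hx : (x : ℕ) = 2 * m) :
    2 * zetaReg [x] = -cotCoeff (2 * m) := by
  have hm : m ≠ 0 := fun h => x.ne_zero (by rw [hx, h])
  have hx1 : x ≠ 1 := fun h => by rw [h, PNat.one_coe] at hx; omega
  have hsum := (hasSum_zeta_nat hm).tendsto_sum_nat.comp (tendsto_add_atTop_nat 1)
  have htrunc (N : ℕ) : truncSum N 0 [x] = ∑ n ∈ Finset.range (N + 1), 1 / (n : ℝ) ^ (2 * m) := by
    rw [Finset.range_eq_Ico, Finset.Ico_add_one_right_eq_Icc,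
      ← Finset.sum_Ioc_add_eq_sum_Icc N.zero_le]
    simp [truncSum, hx, hm]
  have hzeta := tendsto_nhds_unique (tendsto_truncSum_zetaReg [] x hx1)
    (hsum.congr fun N => (htrunc N).symm)
  have hpow : (2 : ℝ) ^ (2 * m) = 2 * 2 ^ (2 * m - 1) := (mul_pow_sub_one (by omega) 2).symm
  rw [List.nil_append] at hzeta
  rw [hzeta, cotCoeff_two_mul, mul_pow, hpow]
  ring

theorem symmetricSum_singleton (x : ℕ+) : symmetricSum [x] = -cotCoeff x := by
  have hsymm : symmetricSum [x] = zetaReg [x] + (-1) ^ (x : ℕ) * zetaReg [x] := by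
    simp [symmetricSum, conv_cons, conv_nil, zetaReg_nil, weightSign_nil, weightSign_singleton]
  rcases Nat.even_or_odd (x : ℕ) with heven | hodd
  · obtain ⟨m, hm⟩ := even_iff_exists_two_mul.1 heven
    rw [hsymm, heven.neg_one_pow, one_mul, ← two_mul, two_mul_zetaReg_singleton hm, hm]
  · rw [hsymm, hodd.neg_one_pow, cotCoeff_of_odd hodd]
    ring

/-- The contribution of the letter `x` of `u ++ x :: v` to the reduction of the symmetric sum. -/
noncomputable def reductionTerm (u : List ℕ+) (x : ℕ+) (v : List ℕ+) : ℝ :=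
  ∑ p ∈ antidiagonal (x : ℕ), sideCoeff u v p.1 * cotCoeff p.2

theorem poleDefect_zero (u : List ℕ+) (x : ℕ+) (v : List ℕ+) :
    poleDefect x u v 0 = (reductionTerm u x v : ℂ) := by
  have hmono (t : ℕ) (ht : t ∈ Finset.range (x : ℕ)) :
      symmetricSum [Nat.succPNat ((x : ℕ) - 1 - t)] = -cotCoeff (x - t) := by
    have ht' := Finset.mem_range.1 ht
    rw [symmetricSum_singleton, Nat.succPNat_coe]
    congr 2
    omega
  rw [poleDefect, taylorRemainder_zero _ (analyticAt_sideProduct u v), taylorCoeff_sideProduct,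
    reductionTerm,
    Finset.Nat.sum_antidiagonal_eq_sum_range_succ fun t e => sideCoeff u v t * cotCoeff e,
    Finset.sum_range_succ, Nat.sub_self, cotCoeff_zero]
  simp only [multitangentAway_zero]
  norm_cast
  rw [Finset.sum_congr rfl fun t ht => by rw [hmono t ht, mul_neg], Finset.sum_neg_distrib]
  ring

theorem symmetricSum_eq (k : List ℕ+) : symmetricSum k = deltaTerm k -
    ∑ j : Fin k.length, reductionTerm (k.take j) (k.get j) (k.drop (j + 1)) := by
  have hzero := multitangentDefect_zero k
  simp only [multitangentDefect, multitangentAway_zero, poleDefect_zero] at hzero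
  norm_cast at hzero
  exact eq_sub_of_add_eq hzero

/-! ### The parity formula -/

theorem mem_triples {n a m b : ℕ} : (a, m, b) ∈ triples n ↔ a + 2 * m + b = n := by
  simp only [triples, Finset.mem_filter, Finset.mem_product, Finset.mem_range]
  omega

theorem sum_triples {R : Type*} [CommSemiring R] {c : ℕ → R} (hc : ∀ e, Odd e → c e = 0) (n : ℕ)
    (f g : ℕ → R) : ∑ t ∈ triples n, f t.1 * c (2 * t.2.1) * g t.2.2 =
      ∑ p ∈ antidiagonal n, (∑ q ∈ antidiagonal p.1, f q.1 * g q.2) * c p.2 := by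
  simp only [Finset.sum_mul]
  rw [Finset.sum_sigma']
  refine Finset.sum_of_injOn (fun t => ⟨(t.1 + t.2.2, 2 * t.2.1), (t.1, t.2.2)⟩) ?_ ?_ ?_ ?_
  · rintro ⟨a, m, b⟩ _ ⟨a', m', b'⟩ _ h
    simp only [Sigma.mk.injEq, Prod.mk.injEq, heq_eq_eq] at h
    simp only [Prod.mk.injEq]
    omega
  · rintro ⟨a, m, b⟩ h
    simp only [Finset.mem_coe, mem_triples, Finset.mem_sigma, mem_antidiagonal, and_true] at h ⊢
    omega
  · rintro ⟨⟨s, e⟩, a, b⟩ hmem hrange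
    simp only [Finset.mem_sigma, mem_antidiagonal] at hmem
    rw [hc e, mul_zero]
    refine Nat.not_even_iff_odd.1 fun heven => hrange ?_
    obtain ⟨m, rfl⟩ := even_iff_exists_two_mul.1 heven
    exact ⟨(a, m, b), mem_triples.2 (by omega), by simp [hmem.2]⟩
  · intro t _
    ring

theorem reductionTerm_eq (u : List ℕ+) (x : ℕ+) (v : List ℕ+) : reductionTerm u x v =
    ∑ t ∈ triples x, (-1) ^ (t.2.1 + t.2.2 + weight u + x) *
      ((2 * Real.pi) ^ (2 * t.2.1) / (2 * t.2.1).factorial) * bernoulli (2 * t.2.1) *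
        zetaTaylor t.1 u.reverse * zetaTaylor t.2.2 v := by
  simp only [reductionTerm, sideCoeff]
  rw [← sum_triples (fun _ => cotCoeff_of_odd) x
    (fun a => weightSign u * (-1) ^ a * zetaTaylor a u.reverse) fun b => zetaTaylor b v]
  refine Finset.sum_congr rfl fun t ht => ?_
  have hsum : t.1 + 2 * t.2.1 + t.2.2 = x := mem_triples.1 ht
  have hsign : (-1 : ℝ) ^ (t.2.1 + t.2.2 + weight u + x) =
      weightSign u * (-1) ^ t.1 * (-1) ^ t.2.1 := by
    rw [weightSign, ← pow_add, ← pow_add]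
    exact neg_one_pow_congr (by rw [← hsum]; grind)
  rw [hsign, cotCoeff_two_mul]
  ring

/-- The signed star values `(-1) ^ (k₁ + ⋯ + k_d + d) ζ^{⋆,*}(k₁, …, k_d)`, which invert the values
`(-1) ^ (k₁ + ⋯ + k_d) ζ^*(k_d, …, k₁)` under deconcatenation. -/
noncomputable def signedStar (k : List ℕ+) : ℝ := weightSign k * (lengthSign k * zetaStarReg k)

theorem zetaReg_eq_conv (k : List ℕ+) : zetaReg k = conv signedStar symmetricSum k := by
  have hinverse : conv signedStar (fun l => weightSign l * zetaReg l.reverse) = convUnit := by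
    funext l
    have hmul := conv_mul_mul (weightSign_append (R := ℝ)) (fun l => lengthSign l * zetaStarReg l)
      (fun l => zetaReg l.reverse) l
    rw [conv_zetaStar_reverse] at hmul
    exact hmul.trans (by cases l <;> simp [convUnit, weightSign_nil])
  have hsymm : symmetricSum = conv (fun l => weightSign l * zetaReg l.reverse) zetaReg := rfl
  rw [hsymm, ← conv_assoc, hinverse, conv_unit_left]

theorem zetaReg_eq_conv_sub (k : List ℕ+) : zetaReg k = conv signedStar deltaTerm k -
    conv signedStar
      (fun l => ∑ j : Fin l.length, reductionTerm (l.take j) (l.get j) (l.drop (j + 1))) k := by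
  rw [zetaReg_eq_conv, conv, conv, conv, ← Finset.sum_sub_distrib]
  exact Finset.sum_congr rfl fun i _ => by rw [symmetricSum_eq, mul_sub]

theorem signedStar_mul_deltaTerm {u v : List ℕ+}
    (hparity : ¬ weight (u ++ v) ≡ (u ++ v).length [MOD 2]) :
    signedStar u * deltaTerm v = -((-1) ^ v.length * zetaStarReg u * deltaTerm v) := by
  by_cases hv : Even v.length ∧ v = List.replicate v.length 1
  · have hodd : Odd (weight u + u.length) := by
      have hweight := weight_eq_length (List.eq_replicate_length.1 hv.2)
      rw [weight_append, List.length_append, hweight, Nat.ModEq] at hparity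
      rw [Nat.odd_iff]
      omega
    rw [signedStar, weightSign, lengthSign, ← mul_assoc, ← pow_add, hodd.neg_one_pow,
      hv.1.neg_one_pow]
    ring
  · rw [deltaTerm, if_neg hv]
    ring

theorem conv_signedStar_deltaTerm {k : List ℕ+} (hparity : ¬ weight k ≡ k.length [MOD 2]) :
    conv signedStar deltaTerm k = -zetaStarReg k - ∑ i ∈ Finset.range k.length,
      (-1) ^ (k.length - i) * zetaStarReg (k.take i) * deltaTerm (k.drop i) := by
  have hterm (i : ℕ) : signedStar (k.take i) * deltaTerm (k.drop i) =
      -((-1) ^ (k.length - i) * zetaStarReg (k.take i) * deltaTerm (k.drop i)) := by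
    rw [signedStar_mul_deltaTerm (by rwa [List.take_append_drop]), List.length_drop]
  simp only [conv, hterm]
  rw [Finset.sum_range_succ, Finset.sum_neg_distrib]
  simp [deltaTerm]
  ring

theorem signedStar_mul_reductionTerm (u v : List ℕ+) (x : ℕ+) (w : List ℕ+) :
    signedStar u * reductionTerm v x w = 2 * ∑ t ∈ triples x,
      (-1) ^ (t.2.1 + u.length + t.2.2 + weight (u ++ v ++ [x])) *
        ((2 * Real.pi) ^ (2 * t.2.1) / (2 * (2 * t.2.1).factorial)) * bernoulli (2 * t.2.1) *
          zetaStarReg u * zetaTaylor t.1 v.reverse * zetaTaylor t.2.2 w := by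
  rw [reductionTerm_eq, Finset.mul_sum, Finset.mul_sum]
  refine Finset.sum_congr rfl fun t _ => ?_
  have hweight : weight (u ++ v ++ [x]) = weight u + weight v + x := by
    rw [weight_append, weight_append, weight_cons]
    rfl
  rw [signedStar, weightSign, lengthSign, hweight, mul_comm (2 : ℝ) (Nat.factorial _), ← div_div]
  ring

theorem conv_signedStar_reductionTerm (k : List ℕ+) :
    conv signedStar
      (fun l => ∑ j : Fin l.length, reductionTerm (l.take j) (l.get j) (l.drop (j + 1))) k =
    2 * ∑ j : Fin k.length, ∑ i ∈ Finset.range (j + 1), ∑ t ∈ triples (k.get j),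
      (-1) ^ (t.2.1 + i + t.2.2 + weight (k.take (j + 1))) *
        ((2 * Real.pi) ^ (2 * t.2.1) / (2 * (2 * t.2.1).factorial)) * bernoulli (2 * t.2.1) *
          zetaStarReg (k.take i) * zetaTaylor t.1 ((k.take j).drop i).reverse *
            zetaTaylor t.2.2 (k.drop (j + 1)) := by
  rw [conv_sum_middle, Finset.mul_sum]
  refine Finset.sum_congr rfl fun j _ => ?_
  have hlength : (k.take j).length = j := List.length_take_of_le j.isLt.le
  rw [conv, hlength, Finset.mul_sum]
  refine Finset.sum_congr rfl fun i hi => ?_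
  have hij : i ≤ j := Finset.mem_range_succ_iff.1 hi
  have htake : (k.take j).take i = k.take i := by rw [List.take_take, min_eq_left hij]
  have hprefix : k.take i ++ (k.take j).drop i ++ [k.get j] = k.take (j + 1) := by
    rw [← htake, List.take_append_drop, List.get_eq_getElem, List.take_concat_get']
  rw [signedStar_mul_reductionTerm, htake, hprefix, List.length_take_of_le (hij.trans j.isLt.le)]

end MZV

/-- Here `k = (k₁, …, k_d)` with `d = k.length`, and the summation variable `j : Fin d` counts from
zero, so that the one-based index of the summand is `j + 1` and its entry is `k.get j`; the triple
`t` is `(a, m, b)`. -/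
theorem theorem2p3 (k : List ℕ+) (hpar : ¬ MZV.weight k ≡ k.length [MOD 2]) :
    MZV.zetaReg k =
      (MZV.zetaReg k - MZV.zetaStarReg k) / 2
      - 1 / 2 * ∑ i ∈ Finset.range k.length,
          (-1 : ℝ) ^ (k.length - i) * MZV.zetaStarReg (k.take i) * MZV.deltaTerm (k.drop i)
      - ∑ j : Fin k.length, ∑ i ∈ Finset.range (j + 1), ∑ t ∈ MZV.triples (k.get j),
          (-1 : ℝ) ^ (t.2.1 + i + t.2.2 + MZV.weight (k.take (j + 1)))
            * ((2 * Real.pi) ^ (2 * t.2.1) / (2 * ((2 * t.2.1).factorial : ℝ)))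
            * (bernoulli (2 * t.2.1) : ℝ)
            * MZV.zetaStarReg (k.take i)
            * MZV.zetaTaylor t.1 ((k.take j).drop i).reverse
            * MZV.zetaTaylor t.2.2 (k.drop (j + 1)) := by
  have hzeta := MZV.zetaReg_eq_conv_sub k
  rw [MZV.conv_signedStar_deltaTerm hpar, MZV.conv_signedStar_reductionTerm] at hzeta
  linear_combination hzeta / 2
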